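/- Let $k$ be a field with $\operatorname{char}(k)\neq 2$ and let $g\ge 0$. Let $E=E_{g,g}$ be the graded associative $k$-algebra with basis $e_{\mathcal O}$, $e_{p_i}$, $A_i$ (of degree $0$) and $B_i$, $X_i$, $Y_i$ (of degree $1$), $1\le i\le g$, in which $e_{\mathcal O}, e_{p_1},\dots,e_{p_g}$ are orthogonal idempotents with sum $1$, $A_i=e_{p_i}A_ie_{\mathcal O}$, $B_i=e_{\mathcal O}B_ie_{p_i}$, $X_i=e_{\mathcal O}X_ie_{\mathcal O}$, $Y_i=e_{p_i}Y_ie_{p_i}$, $A_iB_i=Y_i$, $B_iA_i=X_i$, and all other products of two of the elements $A_i,B_i,X_i,Y_i$ are zero. For $d\in\mathbb Z$ let $C^n_d$ be the space of $k$-multilinear maps $E^{n}\to E$ that are homogeneous of internal degree $d$, with the Hochschild differential (for homogeneous $a_0$) $$(\delta f)(a_0,\dots,a_n)=(-1)^{d\,|a_0|}a_0f(a_1,\dots,a_n)+\sum_{j=0}^{n-1}(-1)^{j+1}f(\dots,a_ja_{j+1},\dots)+(-1)^{n+1}f(a_0,\dots,a_{n-1})a_n ,$$ and let $HH^n(E)_d$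 be the $n$-th cohomology of $(C^\bullet_d,\delta)$. For $c\in C^3_{-1}$ let $\alpha_{ij}(c)$ be the coefficient of $X_j$ in $c(B_i,Y_i,A_i)$. Then the map $c\mapsto(\alpha_{ij}(c))_{i\neq j}$ on $3$-cocycles of internal degree $-1$ induces a $k$-linear isomorphism of $HH^3(E)_{-1}$ with the space of $g\times g$ matrices over $k$ with zeros on the diagonal. The same holds if $C^\bullet_d$ is replaced by its subcomplex of normalized cochains relative to the subalgebra $R=\langle e_{\mathcal O},e_{p_1},\dots,e_{p_g}\rangle$, that is, maps of $R$-bimodules $(E/R)^{\otimes_R n}\to E$ of degree $d$; for a $3$-cocycle $c$ of degree $-1$ of this kind one has $c(B_i,Y_i,A_i)=\sum_j\alpha_{ij}(c)X_j$. -/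

import Mathlib

noncomputable section

namespace Hochschild

section Graded

variable {k : Type*} [Field k] {A : Type*} [Ring A] [Algebra k A]

/-- Hochschild `n`-cochains of the `k`-algebra `A` with values in `A`: `k`-multilinear maps
`A × ⋯ × A → A` in `n` arguments. -/
abbrev Cochain (k : Type*) [Field k] (A : Type*) [Ring A] [Algebra k A] (n : ℕ) : Type _ :=
  MultilinearMap k (fun _ : Fin n => A) A

/-! Shortcut instances, equal to those of Mathlib, that let Lean form quotients of spaces of
cochains. -/

instance instAddCommGroupCochain (n : ℕ) : AddCommGroup (Cochain k A n) :=
  MultilinearMap.instAddCommGroup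

instance instAddCommMonoidCochain (n : ℕ) : AddCommMonoid (Cochain k A n) :=
  (instAddCommGroupCochain n).toAddCommMonoid

instance instModuleCochain (n : ℕ) : Module k (Cochain k A n) :=
  MultilinearMap.instModule

/-- The linear map `a ↦ (-1) ^ (d * |a|) a` (for homogeneous `a`): the Koszul sign that appears
when an operation of internal degree `d` is moved past `a`. -/
def koszulTwist (𝒜 : ℤ → Submodule k A) [GradedAlgebra 𝒜] (d : ℤ) : A →ₗ[k] A :=
  (DirectSum.toModule k ℤ A fun i => (((d * i).negOnePow : ℤˣ) : ℤ) • (𝒜 i).subtype) ∘ₗ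
    (DirectSum.decomposeLinearEquiv 𝒜).toLinearMap

theorem koszulTwist_of_mem (𝒜 : ℤ → Submodule k A) [GradedAlgebra 𝒜] (d : ℤ) {i : ℤ} {a : A}
    (ha : a ∈ 𝒜 i) : koszulTwist 𝒜 d a = (((d * i).negOnePow : ℤˣ) : ℤ) • a := by
  simp only [koszulTwist, LinearMap.comp_apply, LinearEquiv.coe_coe,
    DirectSum.decomposeLinearEquiv_apply, DirectSum.decompose_of_mem 𝒜 ha]
  exact (DirectSum.toModule_lof (M := fun i => 𝒜 i) k i (⟨a, ha⟩ : 𝒜 i)).trans rfl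

/-- `merge j (a₀, …, aₙ) = (a₀, …, aⱼ aⱼ₊₁, …, aₙ)`. -/
def merge {n : ℕ} (j : Fin n) (v : Fin (n + 1) → A) : Fin n → A :=
  Fin.contractNth j.castSucc (· * ·) v

theorem merge_update {n : ℕ} (j : Fin n) (v : Fin (n + 1) → A) (i : Fin (n + 1)) :
    ∃ (i' : Fin n) (L : A →ₗ[k] A), ∀ x : A,
      merge j (Function.update v i x) = Function.update (merge j v) i' (L x) := by
  refine ⟨j.predAbove i,
    if i = j.castSucc then LinearMap.mulRight k (v j.succ)
    else if i = j.succ then LinearMap.mulLeft k (v j.castSucc) else LinearMap.id, fun x => ?_⟩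
  ext l
  simp only [merge, Fin.contractNth, Function.update_apply, Fin.predAbove]
  rcases i with ⟨i, hi⟩
  rcases j with ⟨j, hj⟩
  rcases l with ⟨l, hl⟩
  simp only [Fin.ext_iff, Fin.lt_def, Fin.castSucc_mk, Fin.succ_mk]
  split_ifs <;> simp_all <;> omega

/-- The value of the Hochschild differential of an `n`-cochain `f` of internal degree `d`:
`(δf)(a₀, …, aₙ) = (-1) ^ (d |a₀|) a₀ f(a₁, …, aₙ)
  + ∑ⱼ (-1) ^ (j + 1) f(a₀, …, aⱼ aⱼ₊₁, …, aₙ) + (-1) ^ (n + 1) f(a₀, …, aₙ₋₁) aₙ`. -/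
def diffFun (𝒜 : ℤ → Submodule k A) [GradedAlgebra 𝒜] (d : ℤ) {n : ℕ}
    (f : Cochain k A n) (v : Fin (n + 1) → A) : A :=
  koszulTwist 𝒜 d (v 0) * f (fun i => v i.succ)
    + ∑ j : Fin n, (-1 : ℤ) ^ ((j : ℕ) + 1) • f (merge j v)
    + (-1 : ℤ) ^ (n + 1) • (f (fun i => v i.castSucc) * v (Fin.last n))

theorem tail_update {A : Type*} {n : ℕ} (v : Fin (n + 1) → A) (i : Fin n) (x : A) :
    (fun l : Fin n => Function.update v i.succ x l.succ)
      = Function.update (fun l : Fin n => v l.succ) i x := by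
  ext l; simp [Function.update_apply]

theorem init_update {A : Type*} {n : ℕ} (v : Fin (n + 1) → A) (i : Fin n) (x : A) :
    (fun l : Fin n => Function.update v i.castSucc x l.castSucc)
      = Function.update (fun l : Fin n => v l.castSucc) i x := by
  ext l; simp [Function.update_apply]

theorem diffFun_update_add (𝒜 : ℤ → Submodule k A) [GradedAlgebra 𝒜] (d : ℤ) {n : ℕ}
    (f : Cochain k A n) (v : Fin (n + 1) → A) (i : Fin (n + 1)) (x y : A) :
    diffFun 𝒜 d f (Function.update v i (x + y))
      = diffFun 𝒜 d f (Function.update v i x) + diffFun 𝒜 d f (Function.update v i y) := by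
  have h1 : ∀ j : Fin n, f (merge j (Function.update v i (x + y)))
      = f (merge j (Function.update v i x)) + f (merge j (Function.update v i y)) := by
    intro j
    obtain ⟨i', L, h⟩ := merge_update (k := k) j v i
    simp [h]
  have h0 : koszulTwist 𝒜 d (Function.update v i (x + y) 0)
        * f (fun l => Function.update v i (x + y) l.succ)
      = koszulTwist 𝒜 d (Function.update v i x 0) * f (fun l => Function.update v i x l.succ)
        + koszulTwist 𝒜 d (Function.update v i y 0)
          * f (fun l => Function.update v i y l.succ) := by
    refine Fin.cases ?_ (fun i => ?_) i
    · simp [add_mul]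
    · simp only [tail_update, MultilinearMap.map_update_add, mul_add]
      simp [(Fin.succ_ne_zero i).symm]
  have h2 : f (fun l => Function.update v i (x + y) l.castSucc)
        * Function.update v i (x + y) (Fin.last n)
      = f (fun l => Function.update v i x l.castSucc) * Function.update v i x (Fin.last n)
        + f (fun l => Function.update v i y l.castSucc)
          * Function.update v i y (Fin.last n) := by
    refine Fin.lastCases ?_ (fun i => ?_) i
    · simp [mul_add, Fin.castSucc_ne_last]
    · simp only [init_update, MultilinearMap.map_update_add, add_mul]
      simp [(Fin.castSucc_ne_last i).symm]
  simp only [diffFun, h0, h1, h2, smul_add, Finset.sum_add_distrib]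
  abel

theorem diffFun_update_smul (𝒜 : ℤ → Submodule k A) [GradedAlgebra 𝒜] (d : ℤ) {n : ℕ}
    (f : Cochain k A n) (v : Fin (n + 1) → A) (i : Fin (n + 1)) (c : k) (x : A) :
    diffFun 𝒜 d f (Function.update v i (c • x)) = c • diffFun 𝒜 d f (Function.update v i x) := by
  have h1 : ∀ j : Fin n, f (merge j (Function.update v i (c • x)))
      = c • f (merge j (Function.update v i x)) := by
    intro j
    obtain ⟨i', L, h⟩ := merge_update (k := k) j v i
    simp [h]
  have h0 : koszulTwist 𝒜 d (Function.update v i (c • x) 0)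
        * f (fun l => Function.update v i (c • x) l.succ)
      = c • (koszulTwist 𝒜 d (Function.update v i x 0)
        * f (fun l => Function.update v i x l.succ)) := by
    refine Fin.cases ?_ (fun i => ?_) i
    · simp
    · simp only [tail_update, MultilinearMap.map_update_smul, mul_smul_comm]
      simp [(Fin.succ_ne_zero i).symm]
  have h2 : f (fun l => Function.update v i (c • x) l.castSucc)
        * Function.update v i (c • x) (Fin.last n)
      = c • (f (fun l => Function.update v i x l.castSucc)
        * Function.update v i x (Fin.last n)) := by
    refine Fin.lastCases ?_ (fun i => ?_) i
    · simp [Fin.castSucc_ne_last]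
    · simp only [init_update, MultilinearMap.map_update_smul, smul_mul_assoc]
      simp [(Fin.castSucc_ne_last i).symm]
  simp only [diffFun, h0, h1, h2, smul_add, Finset.smul_sum]
  simp only [smul_comm c]

/-- The Hochschild differential on cochains of internal degree `d`. -/
def diff (𝒜 : ℤ → Submodule k A) [GradedAlgebra 𝒜] (d : ℤ) (n : ℕ) :
    Cochain k A n →ₗ[k] Cochain k A (n + 1) where
  toFun f := MultilinearMap.mk' (diffFun 𝒜 d f) (diffFun_update_add 𝒜 d f)
    (diffFun_update_smul 𝒜 d f)
  map_add' f f' := by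
    ext v
    simp only [diffFun, MultilinearMap.mk'_apply, _root_.add_apply, mul_add, add_mul,
      smul_add, Finset.sum_add_distrib]
    abel
  map_smul' c f := by
    ext v
    simp only [diffFun, MultilinearMap.mk'_apply, _root_.smul_apply, mul_smul_comm,
      smul_mul_assoc, smul_add, Finset.smul_sum, RingHom.id_apply, smul_comm c]

/-- Hochschild `n`-cochains of internal degree `d`: they map `𝒜 p₁ × ⋯ × 𝒜 pₙ` into
`𝒜 (p₁ + ⋯ + pₙ + d)`. -/
def cochains (𝒜 : ℤ → Submodule k A) (d : ℤ) (n : ℕ) : Submodule k (Cochain k A n) where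
  carrier := {f | ∀ (p : Fin n → ℤ) (v : Fin n → A), (∀ i, v i ∈ 𝒜 (p i)) →
    f v ∈ 𝒜 (∑ i, p i + d)}
  zero_mem' := fun p v _ => by simp
  add_mem' := fun hf hf' p v hv => Submodule.add_mem _ (hf p v hv) (hf' p v hv)
  smul_mem' := fun c _ hf p v hv => Submodule.smul_mem _ c (hf p v hv)

/-- For a subalgebra `S` (concentrated in degree `0`), the condition that a cochain is
`S`-relative, i.e. a map of `S`-bimodules `A ⊗_S ⋯ ⊗_S A → A`. -/
def IsRelative (S : Subalgebra k A) : (n : ℕ) → Cochain k A n → Prop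
  | 0, f => ∀ s ∈ S, ∀ v, s * f v = f v * s
  | n + 1, f => ∀ s ∈ S, ∀ v : Fin (n + 1) → A,
      f (Function.update v 0 (s * v 0)) = s * f v ∧
      f (Function.update v (Fin.last n) (v (Fin.last n) * s)) = f v * s ∧
      ∀ j : Fin n, f (Function.update v j.castSucc (v j.castSucc * s))
        = f (Function.update v j.succ (s * v j.succ))

/-- The condition that a cochain vanishes as soon as one of its arguments lies in `S`. -/
def IsNormalized (S : Subalgebra k A) {n : ℕ} (f : Cochain k A n) : Prop :=
  ∀ (v : Fin n → A) (i : Fin n), v i ∈ S → f v = 0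

/-- The normalized `S`-relative Hochschild cochains of internal degree `d`, i.e. maps of
`S`-bimodules `(A/S) ⊗_S ⋯ ⊗_S (A/S) → A` of degree `d`. -/
def relCochains (𝒜 : ℤ → Submodule k A) (S : Subalgebra k A) (d : ℤ) (n : ℕ) :
    Submodule k (Cochain k A n) where
  carrier := {f | f ∈ cochains 𝒜 d n ∧ IsRelative S n f ∧ IsNormalized S f}
  zero_mem' := by
    refine ⟨Submodule.zero_mem _, ?_, fun v i _ => by simp⟩
    cases n <;> simp [IsRelative]
  add_mem' := by
    rintro f f' ⟨h1, h2, h3⟩ ⟨h1', h2', h3'⟩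
    refine ⟨Submodule.add_mem _ h1 h1', ?_, fun v i hv => by simp [h3 v i hv, h3' v i hv]⟩
    cases n with
    | zero => intro s hs v; simp [mul_add, add_mul, h2 s hs v, h2' s hs v]
    | succ n =>
      intro s hs v
      obtain ⟨a, b, c⟩ := h2 s hs v
      obtain ⟨a', b', c'⟩ := h2' s hs v
      exact ⟨by simp [a, a', mul_add], by simp [b, b', add_mul], fun j => by simp [c j, c' j]⟩
  smul_mem' := by
    rintro r f ⟨h1, h2, h3⟩
    refine ⟨Submodule.smul_mem _ r h1, ?_, fun v i hv => by simp [h3 v i hv]⟩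
    cases n with
    | zero => intro s hs v; simp [h2 s hs v]
    | succ n =>
      intro s hs v
      obtain ⟨a, b, c⟩ := h2 s hs v
      exact ⟨by simp [a], by simp [b], fun j => by simp [c j]⟩

/-- The `n`-cocycles of a subcomplex `C` of the Hochschild complex (internal degree `d`). -/
def cocycles (𝒜 : ℤ → Submodule k A) [GradedAlgebra 𝒜] (d : ℤ)
    (C : (n : ℕ) → Submodule k (Cochain k A n)) (n : ℕ) : Submodule k (Cochain k A n) :=
  C n ⊓ LinearMap.ker (diff 𝒜 d n)

/-- The `n`-coboundaries of a subcomplex `C` of the Hochschild complex (internal degree `d`). -/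
def coboundaries (𝒜 : ℤ → Submodule k A) [GradedAlgebra 𝒜] (d : ℤ)
    (C : (n : ℕ) → Submodule k (Cochain k A n)) : (n : ℕ) → Submodule k (Cochain k A n)
  | 0 => ⊥
  | n + 1 => (C n).map (diff 𝒜 d n)

/-- The `n`-th cohomology (cocycles modulo coboundaries) of a subcomplex `C` of the Hochschild
complex (internal degree `d`). -/
abbrev Cohomology (𝒜 : ℤ → Submodule k A) [GradedAlgebra 𝒜] (d : ℤ)
    (C : (n : ℕ) → Submodule k (Cochain k A n)) (n : ℕ) : Type _ :=
  cocycles 𝒜 d C n ⧸ (coboundaries 𝒜 d C n).submoduleOf (cocycles 𝒜 d C n)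

/-- `HHⁿ(A)_d`, the component of internal degree `d` of the `n`-th Hochschild cohomology of the
graded `k`-algebra `A`. -/
abbrev HH (𝒜 : ℤ → Submodule k A) [GradedAlgebra 𝒜] (n : ℕ) (d : ℤ) : Type _ :=
  Cohomology 𝒜 d (cochains 𝒜 d) n

/-- `HHⁿ(A)_d` computed by the complex of normalized `S`-relative cochains. -/
abbrev RelHH (𝒜 : ℤ → Submodule k A) [GradedAlgebra 𝒜] (S : Subalgebra k A) (n : ℕ) (d : ℤ) :
    Type _ :=
  Cohomology 𝒜 d (relCochains 𝒜 S d) n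

end Graded

end Hochschild

namespace Egg

/-- Labels of the basis elements of `E_{g,g}`: the idempotents `e_O` and `e_{p_i}`, and the
elements `A_i`, `B_i`, `X_i`, `Y_i`, where `i` runs through `g` values. -/
inductive Idx (g : ℕ) : Type
  | eO : Idx g
  | eP : Fin g → Idx g
  | A : Fin g → Idx g
  | B : Fin g → Idx g
  | X : Fin g → Idx g
  | Y : Fin g → Idx g
  deriving DecidableEq

/-- The degrees of the basis elements. -/
def Idx.deg {g : ℕ} : Idx g → ℤ
  | eO => 0
  | eP _ => 0
  | A _ => 0
  | B _ => 1
  | X _ => 1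
  | Y _ => 1

/-- The algebra `E_{g,g}` over `k`: elements are families of coordinates in the basis. -/
def E (k : Type*) (g : ℕ) : Type _ := Idx g → k

variable {k : Type*} [Field k] {g : ℕ}

instance : AddCommGroup (E k g) := inferInstanceAs (AddCommGroup (Idx g → k))

instance : Module k (E k g) := inferInstanceAs (Module k (Idx g → k))

@[ext] theorem E.ext {k : Type*} {g : ℕ} {x y : E k g} (h : ∀ a, x a = y a) : x = y := funext h

@[simp] theorem add_coord (x y : E k g) (a : Idx g) : (x + y) a = x a + y a := rfl

@[simp] theorem zero_coord (a : Idx g) : (0 : E k g) a = 0 := rfl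

@[simp] theorem smul_coord (c : k) (x : E k g) (a : Idx g) : (c • x) a = c * x a := rfl

/-- The product of `E_{g,g}` in coordinates. The nonzero products of basis elements are those with
the idempotents, where `A_i = e_{p_i} A_i e_O`, `B_i = e_O B_i e_{p_i}`, `X_i = e_O X_i e_O` and
`Y_i = e_{p_i} Y_i e_{p_i}`, and the products `A_i B_i = Y_i` and `B_i A_i = X_i`. -/
def mulFun (x y : E k g) : E k g
  | .eO => x .eO * y .eO
  | .eP i => x (.eP i) * y (.eP i)
  | .A i => x (.eP i) * y (.A i) + x (.A i) * y .eO
  | .B i => x .eO * y (.B i) + x (.B i) * y (.eP i)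
  | .X i => x .eO * y (.X i) + x (.X i) * y .eO + x (.B i) * y (.A i)
  | .Y i => x (.eP i) * y (.Y i) + x (.Y i) * y (.eP i) + x (.A i) * y (.B i)

/-- The unit `e_O + ∑ᵢ e_{p_i}`. -/
def oneFun : E k g
  | .eO => 1
  | .eP _ => 1
  | _ => 0

instance : Ring (E k g) :=
  { (inferInstance : AddCommGroup (E k g)) with
    mul := mulFun
    one := oneFun
    mul_assoc := fun x y z => by
      ext a; cases a <;> change mulFun (mulFun x y) z _ = mulFun x (mulFun y z) _ <;>
        simp only [mulFun] <;> ring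
    one_mul := fun x => by
      ext a; cases a <;> change mulFun oneFun x _ = _ <;> simp [mulFun, oneFun]
    mul_one := fun x => by
      ext a; cases a <;> change mulFun x oneFun _ = _ <;> simp [mulFun, oneFun]
    left_distrib := fun x y z => by
      ext a; cases a <;> change mulFun x (y + z) _ = mulFun x y _ + mulFun x z _ <;>
        simp only [mulFun, add_coord] <;> ring
    right_distrib := fun x y z => by
      ext a; cases a <;> change mulFun (x + y) z _ = mulFun x z _ + mulFun y z _ <;>
        simp only [mulFun, add_coord] <;> ring
    zero_mul := fun x => by
      ext a; cases a <;> change mulFun 0 x _ = _ <;> simp [mulFun]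
    mul_zero := fun x => by
      ext a; cases a <;> change mulFun x 0 _ = _ <;> simp [mulFun] }

theorem mul_def (x y : E k g) : x * y = mulFun x y := rfl

instance : Algebra k (E k g) :=
  Algebra.ofModule
    (fun c x y => by ext a; cases a <;> simp only [mul_def, mulFun, smul_coord] <;> ring)
    (fun c x y => by ext a; cases a <;> simp only [mul_def, mulFun, smul_coord] <;> ring)

/-- The basis element with a given label. -/
def b (k : Type*) [Field k] {g : ℕ} (a : Idx g) : E k g := fun a' => if a' = a then 1 else 0

/-- The grading of `E_{g,g}`: the elements of degree `d` are the combinations of basis elements of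
degree `d`. -/
def grading (k : Type*) [Field k] (g : ℕ) (d : ℤ) : Submodule k (E k g) where
  carrier := {x | ∀ a, a.deg ≠ d → x a = 0}
  zero_mem' := fun _ _ => rfl
  add_mem' := fun hx hy a ha => by simp [hx a ha, hy a ha]
  smul_mem' := fun c x hx a ha => by simp [hx a ha]

/-- The projection to the degree `d` component. -/
def gradProj (k : Type*) [Field k] (g : ℕ) (d : ℤ) : E k g →ₗ[k] grading k g d where
  toFun x := ⟨fun a => if a.deg = d then x a else 0, fun a ha => if_neg ha⟩
  map_add' x y := by
    apply Subtype.ext; ext a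
    change (if a.deg = d then (x + y) a else 0)
      = (if a.deg = d then x a else 0) + (if a.deg = d then y a else 0)
    split_ifs <;> simp
  map_smul' c x := by
    apply Subtype.ext; ext a
    change (if a.deg = d then (c • x) a else 0) = c * (if a.deg = d then x a else 0)
    split_ifs <;> simp

theorem gradProj_apply (d : ℤ) (x : E k g) (a : Idx g) :
    (gradProj k g d x : E k g) a = if a.deg = d then x a else 0 := rfl

instance : SetLike.GradedMonoid (grading k g) where
  one_mem := by
    intro a ha
    change oneFun a = 0
    cases a <;> simp_all [Idx.deg, oneFun]
  mul_mem := by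
    intro i j x y hx hy a ha
    have key : ∀ a₁ a₂ : Idx g, a₁.deg + a₂.deg = a.deg → x a₁ * y a₂ = 0 := by
      intro a₁ a₂ h
      by_cases h1 : a₁.deg = i
      · rw [hy a₂ (fun h2 => ha (by rw [← h, h1, h2])), mul_zero]
      · rw [hx a₁ h1, zero_mul]
    rw [mul_def]
    cases a <;> simp only [mulFun] <;> repeat' (first | rw [key _ _ rfl] | simp only [add_zero])

instance : DirectSum.Decomposition (grading k g) :=
  DirectSum.Decomposition.ofLinearMap (grading k g)
    (DirectSum.lof k ℤ (fun d => grading k g d) 0 ∘ₗ gradProj k g 0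
      + DirectSum.lof k ℤ (fun d => grading k g d) 1 ∘ₗ gradProj k g 1)
    (by
      ext x a
      simp only [LinearMap.comp_apply, LinearMap.add_apply, map_add, LinearMap.id_apply,
        DirectSum.coeLinearMap_lof, add_coord, gradProj_apply]
      cases a <;> simp [Idx.deg])
    (by
      refine DirectSum.linearMap_ext k fun d => LinearMap.ext fun x => ?_
      have h1 : ∀ e : ℤ, e ≠ d → gradProj k g e (x : E k g) = 0 := by
        intro e he
        apply Subtype.ext
        ext a
        rw [gradProj_apply]
        split_ifs with h
        · exact x.2 a (h ▸ he)
        · rfl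
      have h2 : gradProj k g d (x : E k g) = x := by
        apply Subtype.ext
        ext a
        rw [gradProj_apply]
        split_ifs with h
        · rfl
        · exact (x.2 a h).symm
      simp only [LinearMap.comp_apply, LinearMap.add_apply, DirectSum.coeLinearMap_lof,
        LinearMap.id_apply]
      by_cases hd0 : d = 0
      · subst hd0
        rw [h2, h1 1 (by norm_num), map_zero, add_zero]
      · by_cases hd1 : d = 1
        · subst hd1
          rw [h2, h1 0 (by norm_num), map_zero, zero_add]
        · have hx : x = 0 := by
            apply Subtype.ext
            ext a
            exact x.2 a (by cases a <;> simp [Idx.deg, Ne.symm hd0, Ne.symm hd1])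
          simp [hx])

instance : GradedAlgebra (grading k g) where

/-- The subalgebra `R` of `E_{g,g}` spanned by the idempotents `e_O` and `e_{p_i}`. -/
def idempotents (k : Type*) [Field k] (g : ℕ) : Subalgebra k (E k g) :=
  Algebra.adjoin k (insert (b k .eO) (Set.range fun i : Fin g => b k (.eP i)))

/-- The constant `α_{ij}(c)`: the coefficient of `X_j` in `c(B_i, Y_i, A_i)`. -/
def alpha (c : Hochschild.Cochain k (E k g) 3) (i j : Fin g) : k :=
  (c ![b k (.B i), b k (.Y i), b k (.A i)] : E k g) (.X j)

/-- The space of `g × g` matrices with zero diagonal. -/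
def zeroDiag (k : Type*) [Field k] (g : ℕ) : Submodule k (Matrix (Fin g) (Fin g) k) where
  carrier := {M | ∀ i, M i i = 0}
  zero_mem' := fun _ => rfl
  add_mem' := fun hM hN i => by simp [hM i, hN i]
  smul_mem' := fun c M hM i => by simp [hM i]

end Egg

end

/-!
The span of the idempotents is a separable subalgebra of degree `0`, and averaging over its
separability idempotent changes every cocycle by a coboundary into a normalized relative one. A
relative `3`-cochain of degree `-1` only has coefficients along composable paths with matching
endpoints and degree. There are eight families of such paths, and the cocycle identities on
`(A, B, A, B)` and `(B, A, B, A)` express two of them through the other six. Relative `2`-cochains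
remove these six except for the coefficients of `X_l` at `(B_i, Y_i, A_i)` with `l ≠ i`, which no
coboundary changes: both `B_i Y_i` and `Y_i A_i` vanish, so that the `2`-cochain only contributes to
the coefficient of `X_i`. The characteristic enters because the values at `(B_i, Y_i)` and
`(Y_i, A_i)` have both their sum and their difference prescribed.
-/

noncomputable section

namespace Hochschild

section Cochains

variable {k : Type*} [Field k] {A : Type*} [Ring A] [Algebra k A]

/-- A binary cochain as a bilinear map. -/
def curryTwo : Cochain k A 2 ≃ₗ[k] A →ₗ[k] A →ₗ[k] A :=
  multilinearCurryLeftEquiv k (fun _ : Fin 2 => A) A ≪≫ₗ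
    LinearEquiv.congrRight (MultilinearMap.ofSubsingletonₗ k k A A (0 : Fin 1)).symm

/-- A ternary cochain as a trilinear map. -/
def curryThree : Cochain k A 3 ≃ₗ[k] A →ₗ[k] A →ₗ[k] A →ₗ[k] A :=
  multilinearCurryLeftEquiv k (fun _ : Fin 3 => A) A ≪≫ₗ LinearEquiv.congrRight curryTwo

theorem curryTwo_symm_apply (F : A →ₗ[k] A →ₗ[k] A) (x y : A) :
    curryTwo.symm F ![x, y] = F x y :=
  rfl

theorem curryThree_apply (f : Cochain k A 3) (x y z : A) : curryThree f x y z = f ![x, y, z] :=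
  congrArg f (List.ofFn_inj.1 rfl)

theorem Cochain.ext_four {f f' : Cochain k A 4}
    (h : ∀ x y z w, f ![x, y, z, w] = f' ![x, y, z, w]) : f = f' := by
  ext v
  rw [← FinVec.etaExpand_eq v]
  exact h _ _ _ _

theorem mem_cochains_two_iff {𝒜 : ℤ → Submodule k A} {d : ℤ} {f : Cochain k A 2} :
    f ∈ cochains 𝒜 d 2 ↔ ∀ p q x y, x ∈ 𝒜 p → y ∈ 𝒜 q → f ![x, y] ∈ 𝒜 (p + q + d) := by
  refine ⟨fun h p q x y hx hy => ?_, fun h p v hv => ?_⟩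
  · have h := h ![p, q] ![x, y] (Fin.forall_fin_two.2 ⟨hx, hy⟩)
    rwa [Fin.sum_univ_two] at h
  · rw [← FinVec.etaExpand_eq v, Fin.sum_univ_two]
    exact h _ _ _ _ (hv 0) (hv 1)

theorem mem_cochains_three_iff {𝒜 : ℤ → Submodule k A} {d : ℤ} {f : Cochain k A 3} :
    f ∈ cochains 𝒜 d 3 ↔ ∀ p q r x y z, x ∈ 𝒜 p → y ∈ 𝒜 q → z ∈ 𝒜 r →
      f ![x, y, z] ∈ 𝒜 (p + q + r + d) := by
  refine ⟨fun h p q r x y z hx hy hz => ?_, fun h p v hv => ?_⟩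
  · have h := h ![p, q, r] ![x, y, z]
      (Fin.forall_fin_succ.2 ⟨hx, Fin.forall_fin_two.2 ⟨hy, hz⟩⟩)
    rwa [Fin.sum_univ_three] at h
  · rw [← FinVec.etaExpand_eq v, Fin.sum_univ_three]
    exact h _ _ _ _ _ _ (hv 0) (hv 1) (hv 2)

theorem IsRelative.two {S : Subalgebra k A} {f : Cochain k A 2} (hf : IsRelative S 2 f) {s : A}
    (hs : s ∈ S) (x y : A) :
    f ![s * x, y] = s * f ![x, y] ∧ f ![x, y * s] = f ![x, y] * s ∧
      f ![x * s, y] = f ![x, s * y] := by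
  have update_zero (t : A) : Function.update ![x, y] 0 t = ![t, y] := List.ofFn_inj.1 rfl
  have update_one (t : A) : Function.update ![x, y] 1 t = ![x, t] := List.ofFn_inj.1 rfl
  obtain ⟨left, right, middle⟩ := hf s hs ![x, y]
  refine ⟨?_, ?_, ?_⟩
  · rw [← update_zero]
    exact left
  · rw [← update_one]
    exact right
  · rw [← update_zero (x * s), ← update_one (s * y)]
    exact middle 0

theorem isRelative_three {S : Subalgebra k A} {f : Cochain k A 3}
    (left : ∀ s ∈ S, ∀ x y z, f ![s * x, y, z] = s * f ![x, y, z])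
    (right : ∀ s ∈ S, ∀ x y z, f ![x, y, z * s] = f ![x, y, z] * s)
    (middle₁ : ∀ s ∈ S, ∀ x y z, f ![x * s, y, z] = f ![x, s * y, z])
    (middle₂ : ∀ s ∈ S, ∀ x y z, f ![x, y * s, z] = f ![x, y, s * z]) :
    IsRelative S 3 f := by
  intro s hs v
  obtain ⟨x, y, z, rfl⟩ : ∃ x y z, v = ![x, y, z] := ⟨_, _, _, (FinVec.etaExpand_eq v).symm⟩
  have update_zero (t : A) : Function.update ![x, y, z] 0 t = ![t, y, z] := List.ofFn_inj.1 rfl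
  have update_one (t : A) : Function.update ![x, y, z] 1 t = ![x, t, z] := List.ofFn_inj.1 rfl
  have update_two (t : A) : Function.update ![x, y, z] 2 t = ![x, y, t] := List.ofFn_inj.1 rfl
  refine ⟨?_, ?_, Fin.forall_fin_two.2 ⟨?_, ?_⟩⟩
  · rw [update_zero]
    exact left s hs x y z
  · change f (Function.update ![x, y, z] 2 _) = _
    rw [update_two]
    exact right s hs x y z
  · change f (Function.update ![x, y, z] 0 _) = f (Function.update ![x, y, z] 1 _)
    rw [update_zero, update_one]
    exact middle₁ s hs x y z
  · change f (Function.update ![x, y, z] 1 _) = f (Function.update ![x, y, z] 2 _)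
    rw [update_one, update_two]
    exact middle₂ s hs x y z

theorem isNormalized_three {S : Subalgebra k A} {f : Cochain k A 3}
    (h₁ : ∀ s ∈ S, ∀ y z, f ![s, y, z] = 0) (h₂ : ∀ s ∈ S, ∀ x z, f ![x, s, z] = 0)
    (h₃ : ∀ s ∈ S, ∀ x y, f ![x, y, s] = 0) : IsNormalized S f := by
  intro v i hv
  rw [← FinVec.etaExpand_eq v]
  fin_cases i
  · exact h₁ _ hv _ _
  · exact h₂ _ hv _ _
  · exact h₃ _ hv _ _

end Cochains

section Differential

variable {k : Type*} [Field k] {A : Type*} [Ring A] [Algebra k A]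
  {𝒜 : ℤ → Submodule k A} [GradedAlgebra 𝒜] {d : ℤ}

theorem koszulTwist_of_mem_zero {a : A} (ha : a ∈ 𝒜 0) : koszulTwist 𝒜 d a = a := by
  simp [koszulTwist_of_mem 𝒜 d ha]

theorem koszulTwist_mem {i : ℤ} {a : A} (ha : a ∈ 𝒜 i) : koszulTwist 𝒜 d a ∈ 𝒜 i := by
  rw [koszulTwist_of_mem 𝒜 d ha]
  exact zsmul_mem ha _

theorem koszulTwist_mul (a b : A) :
    koszulTwist 𝒜 d (a * b) = koszulTwist 𝒜 d a * koszulTwist 𝒜 d b := by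
  induction a using DirectSum.Decomposition.inductionOn 𝒜 with
  | zero => simp
  | add a a' ha ha' => simp [add_mul, ha, ha']
  | @homogeneous i a =>
    induction b using DirectSum.Decomposition.inductionOn 𝒜 with
    | zero => simp
    | add b b' hb hb' => simp [mul_add, hb, hb']
    | @homogeneous j b =>
      rw [koszulTwist_of_mem 𝒜 d a.2, koszulTwist_of_mem 𝒜 d b.2,
        koszulTwist_of_mem 𝒜 d (SetLike.mul_mem_graded a.2 b.2), mul_add, Int.negOnePow_add,
        smul_mul_smul_comm]
      simp

theorem diff_two_apply (f : Cochain k A 2) (x y z : A) :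
    diff 𝒜 d 2 f ![x, y, z] =
      koszulTwist 𝒜 d x * f ![y, z] - f ![x * y, z] + f ![x, y * z] - f ![x, y] * z := by
  have merge_zero : merge (0 : Fin 2) ![x, y, z] = ![x * y, z] := List.ofFn_inj.1 rfl
  have merge_one : merge (1 : Fin 2) ![x, y, z] = ![x, y * z] := List.ofFn_inj.1 rfl
  have tail : (fun i : Fin 2 => ![x, y, z] i.succ) = ![y, z] := List.ofFn_inj.1 rfl
  have init : (fun i : Fin 2 => ![x, y, z] i.castSucc) = ![x, y] := List.ofFn_inj.1 rfl
  change diffFun 𝒜 d f ![x, y, z] = _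
  rw [diffFun, Fin.sum_univ_two, merge_zero, merge_one, tail, init]
  change koszulTwist 𝒜 d x * f ![y, z] + ((-1 : ℤ) ^ (0 + 1) • f ![x * y, z]
    + (-1 : ℤ) ^ (1 + 1) • f ![x, y * z]) + (-1 : ℤ) ^ (2 + 1) • (f ![x, y] * z) = _
  norm_num
  abel

theorem diff_three_apply (f : Cochain k A 3) (x y z w : A) :
    diff 𝒜 d 3 f ![x, y, z, w] =
      koszulTwist 𝒜 d x * f ![y, z, w] - f ![x * y, z, w] + f ![x, y * z, w]
        - f ![x, y, z * w] + f ![x, y, z] * w := by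
  have merge_zero : merge (0 : Fin 3) ![x, y, z, w] = ![x * y, z, w] := List.ofFn_inj.1 rfl
  have merge_one : merge (1 : Fin 3) ![x, y, z, w] = ![x, y * z, w] := List.ofFn_inj.1 rfl
  have merge_two : merge (2 : Fin 3) ![x, y, z, w] = ![x, y, z * w] := List.ofFn_inj.1 rfl
  have tail : (fun i : Fin 3 => ![x, y, z, w] i.succ) = ![y, z, w] := List.ofFn_inj.1 rfl
  have init : (fun i : Fin 3 => ![x, y, z, w] i.castSucc) = ![x, y, z] := List.ofFn_inj.1 rfl
  change diffFun 𝒜 d f ![x, y, z, w] = _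
  rw [diffFun, Fin.sum_univ_three, merge_zero, merge_one, merge_two, tail, init]
  change koszulTwist 𝒜 d x * f ![y, z, w] + ((-1 : ℤ) ^ (0 + 1) • f ![x * y, z, w]
    + (-1 : ℤ) ^ (1 + 1) • f ![x, y * z, w] + (-1 : ℤ) ^ (2 + 1) • f ![x, y, z * w])
    + (-1 : ℤ) ^ (3 + 1) • (f ![x, y, z] * w) = _
  norm_num
  abel

theorem cocycle_identity {c : Cochain k A 3} (hc : diff 𝒜 d 3 c = 0) (x y z w : A) :
    koszulTwist 𝒜 d x * c ![y, z, w] - c ![x * y, z, w] + c ![x, y * z, w]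
      - c ![x, y, z * w] + c ![x, y, z] * w = 0 := by
  rw [← diff_three_apply, hc, _root_.zero_apply]

theorem diff_three_diff_two (f : Cochain k A 2) : diff 𝒜 d 3 (diff 𝒜 d 2 f) = 0 := by
  refine Cochain.ext_four fun x y z w => ?_
  simp only [diff_three_apply, diff_two_apply, koszulTwist_mul, _root_.zero_apply, mul_assoc]
  noncomm_ring

theorem diff_two_mem_cochains {f : Cochain k A 2} (hf : f ∈ cochains 𝒜 d 2) :
    diff 𝒜 d 2 f ∈ cochains 𝒜 d 3 := by
  rw [mem_cochains_two_iff] at hf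
  rw [mem_cochains_three_iff]
  intro p q r x y z hx hy hz
  rw [diff_two_apply]
  refine sub_mem (add_mem (sub_mem ?_ ?_) ?_) ?_
  · convert SetLike.mul_mem_graded (koszulTwist_mem hx) (hf _ _ _ _ hy hz) using 2
    ring
  · exact hf _ _ _ _ (SetLike.mul_mem_graded hx hy) hz
  · convert hf _ _ _ _ hx (SetLike.mul_mem_graded hy hz) using 2
    ring
  · convert SetLike.mul_mem_graded (hf _ _ _ _ hx hy) hz using 2
    ring

theorem diff_two_mem_cocycles {f : Cochain k A 2} (hf : f ∈ cochains 𝒜 d 2) :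
    diff 𝒜 d 2 f ∈ cocycles 𝒜 d (cochains 𝒜 d) 3 :=
  ⟨diff_two_mem_cochains hf, diff_three_diff_two f⟩

section Relative

variable {S : Subalgebra k A}

theorem left_linear_of_vanishing {c : Cochain k A 3} (hS : ∀ s ∈ S, s ∈ 𝒜 0)
    (hc : diff 𝒜 d 3 c = 0) (h₁ : ∀ s ∈ S, ∀ y z, c ![s, y, z] = 0) (s : A) (hs : s ∈ S)
    (x y z : A) : c ![s * x, y, z] = s * c ![x, y, z] := by
  have h := cocycle_identity hc s x y z
  simp only [koszulTwist_of_mem_zero (hS s hs), h₁ s hs, zero_mul, add_zero, sub_zero] at h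
  exact (sub_eq_zero.1 h).symm

theorem right_linear_of_vanishing {c : Cochain k A 3} (hc : diff 𝒜 d 3 c = 0)
    (h₃ : ∀ s ∈ S, ∀ x y, c ![x, y, s] = 0) (s : A) (hs : s ∈ S) (x y z : A) :
    c ![x, y, z * s] = c ![x, y, z] * s := by
  have h := cocycle_identity hc x y z s
  simp only [h₃ s hs, mul_zero, sub_zero, zero_add, zero_sub] at h
  exact neg_add_eq_zero.1 h

theorem isRelative_of_isNormalized {c : Cochain k A 3} (hS : ∀ s ∈ S, s ∈ 𝒜 0)
    (hc : diff 𝒜 d 3 c = 0) (hn : IsNormalized S c) : IsRelative S 3 c := by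
  have h₁ : ∀ s ∈ S, ∀ y z, c ![s, y, z] = 0 := fun s hs y z => hn _ 0 hs
  have h₂ : ∀ s ∈ S, ∀ x z, c ![x, s, z] = 0 := fun s hs x z => hn _ 1 hs
  have h₃ : ∀ s ∈ S, ∀ x y, c ![x, y, s] = 0 := fun s hs x y => hn _ 2 hs
  refine isRelative_three (left_linear_of_vanishing hS hc h₁) (right_linear_of_vanishing hc h₃)
    (fun s hs x y z => ?_) (fun s hs x y z => ?_)
  · have h := cocycle_identity hc x s y z
    simp only [h₁ s hs, h₂ s hs, mul_zero, zero_mul, zero_sub, sub_zero, add_zero] at h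
    exact neg_add_eq_zero.1 h
  · have h := cocycle_identity hc x y s z
    simp only [h₂ s hs, h₃ s hs, mul_zero, zero_mul, zero_add, sub_zero, add_zero] at h
    exact sub_eq_zero.1 h

theorem mem_relCocycles_of_isNormalized {c : Cochain k A 3} (hS : ∀ s ∈ S, s ∈ 𝒜 0)
    (hc : c ∈ cocycles 𝒜 d (cochains 𝒜 d) 3) (hn : IsNormalized S c) :
    c ∈ cocycles 𝒜 d (relCochains 𝒜 S d) 3 :=
  ⟨⟨hc.1, isRelative_of_isNormalized hS hc.2 hn, hn⟩, hc.2⟩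

theorem diff_two_mem_relCocycles {f : Cochain k A 2} (hS : ∀ s ∈ S, s ∈ 𝒜 0)
    (hf : f ∈ relCochains 𝒜 S d 2) : diff 𝒜 d 2 f ∈ cocycles 𝒜 d (relCochains 𝒜 S d) 3 := by
  obtain ⟨hdeg, hrel, hn⟩ := hf
  have h₁ : ∀ s ∈ S, ∀ y, f ![s, y] = 0 := fun s hs y => hn _ 0 hs
  have h₂ : ∀ s ∈ S, ∀ x, f ![x, s] = 0 := fun s hs x => hn _ 1 hs
  refine mem_relCocycles_of_isNormalized hS (diff_two_mem_cocycles hdeg)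
    (isNormalized_three (fun s hs y z => ?_) (fun s hs x z => ?_) (fun s hs x y => ?_))
  · simp [diff_two_apply, koszulTwist_of_mem_zero (hS s hs), h₁ s hs, (hrel.two hs y z).1]
  · simp [diff_two_apply, h₁ s hs, h₂ s hs, (hrel.two hs x z).2.2]
  · simp [diff_two_apply, h₂ s hs, (hrel.two hs x y).2.1]

end Relative

end Differential

section Separability

open scoped TensorProduct

variable {k : Type*} [Field k] {A : Type*} [Ring A] [Algebra k A] {ι : Type*} [Fintype ι]

/-- The elements `p v` and `q v` of the subalgebra `S` are the factors of a separability idempotent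
`∑ v, p v ⊗ q v` of `S`. The tensor product is taken over `k` in `A ⊗ A` rather than in `S ⊗ S`. -/
structure IsSeparabilitySystem (S : Subalgebra k A) (p q : ι → A) : Prop where
  left_mem (v : ι) : p v ∈ S
  right_mem (v : ι) : q v ∈ S
  sum_mul : ∑ v, p v * q v = 1
  sum_tmul (s : A) (hs : s ∈ S) : ∑ v, (s * p v) ⊗ₜ[k] q v = ∑ v, p v ⊗ₜ[k] (q v * s)

theorem IsSeparabilitySystem.sum_apply {S : Subalgebra k A} {p q : ι → A}
    (h : IsSeparabilitySystem S p q) (B : A →ₗ[k] A →ₗ[k] A) {s : A} (hs : s ∈ S) :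
    ∑ v, B (s * p v) (q v) = ∑ v, B (p v) (q v * s) := by
  simpa only [map_sum, TensorProduct.lift.tmul] using
    congrArg (TensorProduct.lift B) (h.sum_tmul s hs)

theorem isSeparabilitySystem_of_completeOrthogonalIdempotents {e : ι → A}
    (he : CompleteOrthogonalIdempotents e) :
    IsSeparabilitySystem (Algebra.adjoin k (Set.range e)) e e where
  left_mem v := Algebra.subset_adjoin ⟨v, rfl⟩
  right_mem v := Algebra.subset_adjoin ⟨v, rfl⟩
  sum_mul := by simp only [(he.idem _).eq, he.complete]
  sum_tmul s hs := by
    classical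
    set ε : A ⊗[k] A := ∑ v, e v ⊗ₜ e v with hε
    suffices (s ⊗ₜ[k] (1 : A)) * ε = ε * ((1 : A) ⊗ₜ[k] s) by
      simpa only [hε, Finset.mul_sum, Finset.sum_mul, Algebra.TensorProduct.tmul_mul_tmul, one_mul,
        mul_one] using this
    induction hs using Algebra.adjoin_induction with
    | mem s hs =>
      obtain ⟨w, rfl⟩ := hs
      simp [hε, Finset.mul_sum, Finset.sum_mul, he.mul_eq, TensorProduct.ite_tmul,
        TensorProduct.tmul_ite]
    | algebraMap r =>
      rw [← Algebra.TensorProduct.algebraMap_apply, Algebra.commutes,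
        Algebra.TensorProduct.algebraMap_apply']
    | add s t _ _ hs ht =>
      rw [TensorProduct.add_tmul, TensorProduct.tmul_add, add_mul, mul_add, hs, ht]
    | mul s t _ _ hs ht =>
      calc ((s * t) ⊗ₜ[k] (1 : A)) * ε = (s ⊗ₜ[k] (1 : A)) * ((t ⊗ₜ[k] (1 : A)) * ε) := by
            rw [← mul_assoc, Algebra.TensorProduct.tmul_mul_tmul, one_mul]
        _ = ε * ((1 : A) ⊗ₜ[k] (s * t)) := by
            rw [ht, ← mul_assoc, hs, mul_assoc, Algebra.TensorProduct.tmul_mul_tmul, one_mul]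

/-- The binary cochain `∑ v, p v * c (q v, y, z)`, which corrects the first slot of `c`. -/
def leftAverage (p q : ι → A) (c : Cochain k A 3) : Cochain k A 2 :=
  curryTwo.symm (∑ v, (curryThree c (q v)).compr₂ (LinearMap.mulLeft k (p v)))

/-- The binary cochain `∑ v, c (x, y, p v) * q v`, which corrects the last slot of `c`. -/
def rightAverage (p q : ι → A) (c : Cochain k A 3) : Cochain k A 2 :=
  curryTwo.symm
    (∑ v, (curryThree c).compr₂ (LinearMap.mulRight k (q v) ∘ₗ LinearMap.applyₗ (p v)))

/-- The binary cochain `∑ v, c (x * p v, q v, z)`, which corrects the middle slot of `c`. -/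
def middleAverage (p q : ι → A) (c : Cochain k A 3) : Cochain k A 2 :=
  curryTwo.symm (∑ v, (curryThree c).flip (q v) ∘ₗ LinearMap.mulRight k (p v))

theorem leftAverage_apply (p q : ι → A) (c : Cochain k A 3) (y z : A) :
    leftAverage p q c ![y, z] = ∑ v, p v * c ![q v, y, z] := by
  simp [leftAverage, curryTwo_symm_apply, curryThree_apply]

theorem rightAverage_apply (p q : ι → A) (c : Cochain k A 3) (x y : A) :
    rightAverage p q c ![x, y] = ∑ v, c ![x, y, p v] * q v := by
  simp [rightAverage, curryTwo_symm_apply, curryThree_apply]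

theorem middleAverage_apply (p q : ι → A) (c : Cochain k A 3) (x z : A) :
    middleAverage p q c ![x, z] = ∑ v, c ![x * p v, q v, z] := by
  simp [middleAverage, curryTwo_symm_apply, curryThree_apply]

variable {𝒜 : ℤ → Submodule k A} [GradedAlgebra 𝒜] {d : ℤ} {S : Subalgebra k A} {p q : ι → A}
  {c : Cochain k A 3}

theorem leftAverage_mem_cochains (hp : ∀ v, p v ∈ 𝒜 0) (hq : ∀ v, q v ∈ 𝒜 0)
    (hc : c ∈ cochains 𝒜 d 3) : leftAverage p q c ∈ cochains 𝒜 d 2 := by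
  rw [mem_cochains_three_iff] at hc
  refine mem_cochains_two_iff.2 fun i j y z hy hz => ?_
  rw [leftAverage_apply]
  refine sum_mem fun v _ => ?_
  simpa only [zero_add] using SetLike.mul_mem_graded (hp v) (hc _ _ _ _ _ _ (hq v) hy hz)

theorem rightAverage_mem_cochains (hp : ∀ v, p v ∈ 𝒜 0) (hq : ∀ v, q v ∈ 𝒜 0)
    (hc : c ∈ cochains 𝒜 d 3) : rightAverage p q c ∈ cochains 𝒜 d 2 := by
  rw [mem_cochains_three_iff] at hc
  refine mem_cochains_two_iff.2 fun i j x y hx hy => ?_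
  rw [rightAverage_apply]
  refine sum_mem fun v _ => ?_
  simpa only [add_zero] using SetLike.mul_mem_graded (hc _ _ _ _ _ _ hx hy (hp v)) (hq v)

theorem middleAverage_mem_cochains (hp : ∀ v, p v ∈ 𝒜 0) (hq : ∀ v, q v ∈ 𝒜 0)
    (hc : c ∈ cochains 𝒜 d 3) : middleAverage p q c ∈ cochains 𝒜 d 2 := by
  rw [mem_cochains_three_iff] at hc
  refine mem_cochains_two_iff.2 fun i j x z hx hz => ?_
  rw [middleAverage_apply]
  refine sum_mem fun v _ => ?_
  simpa only [add_zero] using hc _ _ _ _ _ _ (SetLike.mul_mem_graded hx (hp v)) (hq v) hz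

theorem diff_leftAverage (h : IsSeparabilitySystem S p q) (hS : ∀ s ∈ S, s ∈ 𝒜 0)
    (hc : diff 𝒜 d 3 c = 0) (s : A) (hs : s ∈ S) (y z : A) :
    diff 𝒜 d 2 (leftAverage p q c) ![s, y, z] = c ![s, y, z] := by
  have move : ∑ v, p v * c ![q v * s, y, z] = s * ∑ v, p v * c ![q v, y, z] := by
    simpa [curryThree_apply, mul_assoc, Finset.mul_sum] using (h.sum_apply
      ((LinearMap.mul k A).compl₂ (((curryThree c).flip y).flip z)) hs).symm
  have identity : ∑ v, p v * (q v * c ![s, y, z] - c ![q v * s, y, z] + c ![q v, s * y, z]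
      - c ![q v, s, y * z] + c ![q v, s, y] * z) = 0 :=
    Finset.sum_eq_zero fun v _ => by
      have identity := cocycle_identity hc (q v) s y z
      rw [koszulTwist_of_mem_zero (hS _ (h.right_mem v))] at identity
      rw [identity, mul_zero]
  simp only [mul_add, mul_sub, ← mul_assoc, Finset.sum_add_distrib, Finset.sum_sub_distrib,
    ← Finset.sum_mul, h.sum_mul, one_mul, move] at identity
  simp only [diff_two_apply, koszulTwist_of_mem_zero (hS s hs), leftAverage_apply]
  linear_combination (norm := abel) -identity

theorem diff_rightAverage_left (hS : ∀ s ∈ S, s ∈ 𝒜 0) (hc : diff 𝒜 d 3 c = 0)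
    (h₁ : ∀ s ∈ S, ∀ y z, c ![s, y, z] = 0) (s : A) (hs : s ∈ S) (y z : A) :
    diff 𝒜 d 2 (rightAverage p q c) ![s, y, z] = 0 := by
  simp [diff_two_apply, koszulTwist_of_mem_zero (hS s hs), rightAverage_apply, h₁ s hs,
    left_linear_of_vanishing hS hc h₁ s hs, Finset.mul_sum, mul_assoc]

theorem diff_rightAverage (h : IsSeparabilitySystem S p q) (hc : diff 𝒜 d 3 c = 0) (s : A)
    (hs : s ∈ S) (x y : A) :
    diff 𝒜 d 2 (rightAverage p q c) ![x, y, s] = -c ![x, y, s] := by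
  have move : ∑ v, c ![x, y, s * p v] * q v = (∑ v, c ![x, y, p v] * q v) * s := by
    simpa [curryThree_apply, mul_assoc, Finset.sum_mul] using
      h.sum_apply (LinearMap.mul k A ∘ₗ curryThree c x y) hs
  have identity : ∑ v, (koszulTwist 𝒜 d x * c ![y, s, p v] - c ![x * y, s, p v]
      + c ![x, y * s, p v] - c ![x, y, s * p v] + c ![x, y, s] * p v) * q v = 0 :=
    Finset.sum_eq_zero fun v _ => by rw [cocycle_identity hc, zero_mul]
  simp only [add_mul, sub_mul, mul_assoc, Finset.sum_add_distrib, Finset.sum_sub_distrib,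
    ← Finset.mul_sum, h.sum_mul, mul_one, move] at identity
  simp only [diff_two_apply, rightAverage_apply]
  linear_combination (norm := abel) identity

theorem diff_middleAverage_left (h : IsSeparabilitySystem S p q) (hS : ∀ s ∈ S, s ∈ 𝒜 0)
    (hc : diff 𝒜 d 3 c = 0) (h₁ : ∀ s ∈ S, ∀ y z, c ![s, y, z] = 0) (s : A) (hs : s ∈ S)
    (y z : A) : diff 𝒜 d 2 (middleAverage p q c) ![s, y, z] = 0 := by
  have vanish (z : A) : middleAverage p q c ![s, z] = 0 := by
    rw [middleAverage_apply]
    exact Finset.sum_eq_zero fun v _ => h₁ _ (mul_mem hs (h.left_mem v)) _ _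
  rw [diff_two_apply, koszulTwist_of_mem_zero (hS s hs), vanish, vanish]
  simp [middleAverage_apply, left_linear_of_vanishing hS hc h₁ s hs, Finset.mul_sum, mul_assoc]

theorem diff_middleAverage_right (hc : diff 𝒜 d 3 c = 0)
    (h₃ : ∀ s ∈ S, ∀ x y, c ![x, y, s] = 0) (s : A) (hs : s ∈ S) (x y : A) :
    diff 𝒜 d 2 (middleAverage p q c) ![x, y, s] = 0 := by
  simp [diff_two_apply, middleAverage_apply, h₃ s hs, right_linear_of_vanishing hc h₃ s hs,
    Finset.sum_mul]

theorem diff_middleAverage (h : IsSeparabilitySystem S p q) (hc : diff 𝒜 d 3 c = 0)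
    (h₁ : ∀ s ∈ S, ∀ y z, c ![s, y, z] = 0) (h₃ : ∀ s ∈ S, ∀ x y, c ![x, y, s] = 0) (s : A)
    (hs : s ∈ S) (x z : A) :
    diff 𝒜 d 2 (middleAverage p q c) ![x, s, z] = -c ![x, s, z] := by
  have move : ∑ v, c ![x * p v, q v * s, z] = ∑ v, c ![x * s * p v, q v, z] := by
    simpa [curryThree_apply, mul_assoc] using (h.sum_apply
      ((curryThree c ∘ₗ LinearMap.mulLeft k x).compr₂ (LinearMap.applyₗ z)) hs).symm
  have total : ∑ v, c ![x * p v * q v, s, z] = c ![x, s, z] := by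
    simp only [← curryThree_apply, mul_assoc, ← LinearMap.sum_apply, ← map_sum, ← Finset.mul_sum,
      h.sum_mul, mul_one]
  have identity : ∑ v, (-c ![x * p v * q v, s, z] + c ![x * p v, q v * s, z]
      - c ![x * p v, q v, s * z]) = 0 :=
    Finset.sum_eq_zero fun v _ => by
      have identity := cocycle_identity hc (x * p v) (q v) s z
      rwa [h₁ _ (h.right_mem v), h₃ s hs, mul_zero, zero_mul, add_zero, zero_sub] at identity
  simp only [Finset.sum_add_distrib, Finset.sum_sub_distrib, Finset.sum_neg_distrib, total,
    move] at identity
  have vanish_left : ∑ v, c ![s * p v, q v, z] = 0 :=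
    Finset.sum_eq_zero fun v _ => h₁ _ (mul_mem hs (h.left_mem v)) _ _
  simp only [diff_two_apply, middleAverage_apply, vanish_left, h₃ s hs, Finset.sum_const_zero,
    mul_zero, zero_mul]
  linear_combination (norm := abel) -identity

/-- The left average makes the first slot vanish on `S`, then the right average the last one, and
then the middle average the middle one; no step destroys what the previous ones have achieved. -/
theorem exists_sub_diff_mem_relCocycles (h : IsSeparabilitySystem S p q)
    (hS : ∀ s ∈ S, s ∈ 𝒜 0) (hc : c ∈ cocycles 𝒜 d (cochains 𝒜 d) 3) :
    ∃ f ∈ cochains 𝒜 d 2, c - diff 𝒜 d 2 f ∈ cocycles 𝒜 d (relCochains 𝒜 S d) 3 := by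
  have hp (v : ι) : p v ∈ 𝒜 0 := hS _ (h.left_mem v)
  have hq (v : ι) : q v ∈ 𝒜 0 := hS _ (h.right_mem v)
  set f₁ := leftAverage p q c
  have hf₁ : f₁ ∈ cochains 𝒜 d 2 := leftAverage_mem_cochains hp hq hc.1
  set c₁ := c - diff 𝒜 d 2 f₁ with hc₁_def
  have hc₁ : c₁ ∈ cocycles 𝒜 d (cochains 𝒜 d) 3 := sub_mem hc (diff_two_mem_cocycles hf₁)
  have left₁ : ∀ s ∈ S, ∀ y z, c₁ ![s, y, z] = 0 := fun s hs y z => by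
    rw [hc₁_def, _root_.sub_apply, diff_leftAverage h hS hc.2 s hs, sub_self]
  set f₂ := rightAverage p q c₁
  have hf₂ : f₂ ∈ cochains 𝒜 d 2 := rightAverage_mem_cochains hp hq hc₁.1
  set c₂ := c₁ + diff 𝒜 d 2 f₂ with hc₂_def
  have hc₂ : c₂ ∈ cocycles 𝒜 d (cochains 𝒜 d) 3 := add_mem hc₁ (diff_two_mem_cocycles hf₂)
  have left₂ : ∀ s ∈ S, ∀ y z, c₂ ![s, y, z] = 0 := fun s hs y z => by
    rw [hc₂_def, _root_.add_apply, left₁ s hs, diff_rightAverage_left hS hc₁.2 left₁ s hs,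
      add_zero]
  have right₂ : ∀ s ∈ S, ∀ x y, c₂ ![x, y, s] = 0 := fun s hs x y => by
    rw [hc₂_def, _root_.add_apply, diff_rightAverage h hc₁.2 s hs, add_neg_cancel]
  set f₃ := middleAverage p q c₂
  have hf₃ : f₃ ∈ cochains 𝒜 d 2 := middleAverage_mem_cochains hp hq hc₂.1
  have normalized : IsNormalized S (c₂ + diff 𝒜 d 2 f₃) := by
    refine isNormalized_three (fun s hs y z => ?_) (fun s hs x z => ?_) (fun s hs x y => ?_)
    · rw [_root_.add_apply, left₂ s hs, diff_middleAverage_left h hS hc₂.2 left₂ s hs, add_zero]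
    · rw [_root_.add_apply, diff_middleAverage h hc₂.2 left₂ right₂ s hs, add_neg_cancel]
    · rw [_root_.add_apply, right₂ s hs, diff_middleAverage_right hc₂.2 right₂ s hs, add_zero]
  refine ⟨f₁ - f₂ - f₃, sub_mem (sub_mem hf₁ hf₂) hf₃, ?_⟩
  have hsub : c - diff 𝒜 d 2 (f₁ - f₂ - f₃) = c₂ + diff 𝒜 d 2 f₃ := by
    rw [map_sub, map_sub, hc₂_def, hc₁_def]
    abel
  rw [hsub]
  exact mem_relCocycles_of_isNormalized hS (add_mem hc₂ (diff_two_mem_cocycles hf₃)) normalized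

end Separability

theorem exists_cohomology_equiv {k : Type*} [Field k] {A : Type*} [Ring A] [Algebra k A]
    {𝒜 : ℤ → Submodule k A} [GradedAlgebra 𝒜] {d : ℤ}
    {C : (n : ℕ) → Submodule k (Cochain k A n)} {n : ℕ} {V : Type*} [AddCommGroup V] [Module k V]
    (φ : Cochain k A n →ₗ[k] V) (hsurj : ∀ w, ∃ c ∈ cocycles 𝒜 d C n, φ c = w)
    (hker : ∀ c ∈ cocycles 𝒜 d C n, φ c = 0 ↔ c ∈ coboundaries 𝒜 d C n) :
    ∃ Φ : Cohomology 𝒜 d C n ≃ₗ[k] V,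
      ∀ c : cocycles 𝒜 d C n, Φ (Submodule.Quotient.mk c) = φ c := by
  set ψ : cocycles 𝒜 d C n →ₗ[k] V := φ ∘ₗ (cocycles 𝒜 d C n).subtype
  have hker' : (coboundaries 𝒜 d C n).submoduleOf (cocycles 𝒜 d C n) = LinearMap.ker ψ :=
    Submodule.ext fun c => (hker c c.2).symm
  have hsurj' : Function.Surjective ψ := fun w =>
    let ⟨c, hc, hcw⟩ := hsurj w
    ⟨⟨c, hc⟩, hcw⟩
  exact ⟨Submodule.quotEquivOfEq _ _ hker' ≪≫ₗ ψ.quotKerEquivOfSurjective hsurj',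
    fun _ => rfl⟩

end Hochschild

namespace Egg

open Hochschild

section Algebra

variable {k : Type*} [Field k] {g : ℕ}

theorem sub_coord (x y : E k g) (a : Idx g) : (x - y) a = x a - y a :=
  rfl

theorem sum_coord {ι : Type*} (s : Finset ι) (x : ι → E k g) (a : Idx g) :
    (∑ i ∈ s, x i) a = ∑ i ∈ s, x i a :=
  Finset.sum_apply a s x

theorem b_coord (a a' : Idx g) : b k a a' = if a' = a then 1 else 0 :=
  rfl

theorem b_mem_grading (a : Idx g) : b k a ∈ grading k g a.deg := fun _ ha' =>
  if_neg fun h => ha' (congrArg Idx.deg h)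

instance : Finite (Idx g) :=
  Finite.of_injective
    (fun a => match a with
      | .eO => ((0 : Fin 6), (none : Option (Fin g)))
      | .eP i => (1, some i)
      | .A i => (2, some i)
      | .B i => (3, some i)
      | .X i => (4, some i)
      | .Y i => (5, some i))
    (by rintro (_ | _) (_ | _) <;> simp)

/-- The basis `e_O, e_{p_i}, A_i, B_i, X_i, Y_i` of `E_{g,g}`. -/
def basis (k : Type*) [Field k] (g : ℕ) : Module.Basis (Idx g) k (E k g) :=
  Pi.basisFun k (Idx g)

theorem basis_apply (a : Idx g) : basis k g a = b k a := by
  ext a'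
  exact (congrFun (Pi.basisFun_apply k (Idx g) a) a').trans (Pi.single_apply a 1 a')

theorem koszulTwist_coord (d : ℤ) (x : E k g) (a : Idx g) :
    koszulTwist (grading k g) d x a = (((d * a.deg).negOnePow : ℤˣ) : ℤ) * x a := by
  induction x using DirectSum.Decomposition.inductionOn (grading k g) with
  | zero => simp
  | add x y hx hy => rw [map_add, add_coord, add_coord, hx, hy, mul_add]
  | @homogeneous i x =>
    rw [koszulTwist_of_mem _ d x.2, ← Int.cast_smul_eq_zsmul k, smul_coord]
    by_cases ha : a.deg = i
    · rw [ha]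
    · rw [x.2 a ha, mul_zero, mul_zero]

theorem A_mul_B (i j : Fin g) : b k (.A i) * b k (.B j) = if i = j then b k (.Y i) else 0 := by
  ext a
  rw [mul_def]
  cases a <;> grind [mulFun, b_coord, zero_coord]

theorem B_mul_A (i j : Fin g) : b k (.B i) * b k (.A j) = if i = j then b k (.X i) else 0 := by
  ext a
  rw [mul_def]
  cases a <;> grind [mulFun, b_coord, zero_coord]

end Algebra

section Idempotents

variable {k : Type*} [Field k] {g : ℕ}

/-- The idempotents, indexed by the vertices: `none` stands for `O` and `some i` for `p_i`. -/
def vertexIdx : Option (Fin g) → Idx g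
  | none => .eO
  | some i => .eP i

/-- The vertex whose idempotent fixes a basis element from the left. -/
def Idx.left : Idx g → Option (Fin g)
  | .eO => none
  | .eP i => some i
  | .A i => some i
  | .B _ => none
  | .X _ => none
  | .Y i => some i

/-- The vertex whose idempotent fixes a basis element from the right. -/
def Idx.right : Idx g → Option (Fin g)
  | .eO => none
  | .eP i => some i
  | .A _ => none
  | .B i => some i
  | .X _ => none
  | .Y i => some i

/-- The basis elements other than the idempotents. -/
def Idx.IsArrow : Idx g → Prop
  | .eO => False
  | .eP _ => False
  | _ => True

theorem Idx.exists_vertexIdx_eq {a : Idx g} (ha : ¬a.IsArrow) : ∃ v, vertexIdx v = a := by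
  cases a with
  | eO => exact ⟨none, rfl⟩
  | eP i => exact ⟨some i, rfl⟩
  | _ => exact absurd trivial ha

theorem vertexIdx_injective : Function.Injective (vertexIdx (g := g)) := by
  rintro (_ | _) (_ | _) <;> simp [vertexIdx]

theorem idempotents_eq_adjoin_vertices :
    idempotents k g = Algebra.adjoin k (Set.range fun v => b k (vertexIdx v)) := by
  rw [Option.range_eq]
  rfl

theorem vertex_mem_idempotents (v : Option (Fin g)) : b k (vertexIdx v) ∈ idempotents k g := by
  rw [idempotents_eq_adjoin_vertices]
  exact Algebra.subset_adjoin ⟨v, rfl⟩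

theorem completeOrthogonalIdempotents_vertices :
    CompleteOrthogonalIdempotents fun v : Option (Fin g) => b k (vertexIdx v) where
  idem v := by
    ext a
    cases v <;> cases a <;> simp [mul_def, mulFun, b_coord, vertexIdx]
  ortho v w h := by
    ext a
    change (b k (vertexIdx v) * b k (vertexIdx w)) a = 0
    rw [mul_def]
    cases v <;> cases w <;> cases a <;> grind [mulFun, b_coord, vertexIdx]
  complete := by
    ext a
    change _ = oneFun a
    rw [sum_coord, Fintype.sum_option]
    cases a <;> simp [b_coord, vertexIdx, oneFun]

theorem isSeparabilitySystem_vertices :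
    IsSeparabilitySystem (idempotents k g) (fun v => b k (vertexIdx v))
      fun v => b k (vertexIdx v) := by
  rw [idempotents_eq_adjoin_vertices]
  exact isSeparabilitySystem_of_completeOrthogonalIdempotents
    completeOrthogonalIdempotents_vertices

theorem coord_of_mem_idempotents {s : E k g} (hs : s ∈ idempotents k g) (i : Fin g) :
    s (.A i) = 0 ∧ s (.B i) = 0 ∧ s (.X i) = 0 ∧ s (.Y i) = 0 := by
  induction hs using Algebra.adjoin_induction with
  | mem x hx => rcases hx with rfl | ⟨j, rfl⟩ <;> simp [b_coord]
  | algebraMap r =>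
    simp only [Algebra.algebraMap_eq_smul_one, smul_coord]
    change r * oneFun (.A i) = 0 ∧ r * oneFun (.B i) = 0 ∧ r * oneFun (.X i) = 0 ∧
      r * oneFun (.Y i) = 0
    simp [oneFun]
  | add x y _ _ hx hy => simp [hx, hy]
  | mul x y _ _ hx hy => simp [mul_def, mulFun, hx, hy]

theorem coord_eq_zero_of_isArrow {s : E k g} (hs : s ∈ idempotents k g) {a : Idx g}
    (ha : a.IsArrow) : s a = 0 := by
  have h := coord_of_mem_idempotents hs
  cases a <;> simp_all [Idx.IsArrow]

theorem mem_grading_zero_of_mem_idempotents (s : E k g) (hs : s ∈ idempotents k g) :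
    s ∈ grading k g 0 := by
  have h := coord_of_mem_idempotents hs
  intro a ha
  cases a <;> simp_all [Idx.deg]

theorem idempotent_mul_coord {s : E k g} (hs : s ∈ idempotents k g) (x : E k g) (a : Idx g) :
    (s * x) a = s (vertexIdx a.left) * x a := by
  have h := coord_of_mem_idempotents hs
  cases a <;> simp [mul_def, mulFun, vertexIdx, Idx.left, h]

theorem mul_idempotent_coord {s : E k g} (hs : s ∈ idempotents k g) (x : E k g) (a : Idx g) :
    (x * s) a = x a * s (vertexIdx a.right) := by
  have h := coord_of_mem_idempotents hs
  cases a <;> simp [mul_def, mulFun, vertexIdx, Idx.right, h]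

theorem idempotent_mul_b {s : E k g} (hs : s ∈ idempotents k g) (a : Idx g) :
    s * b k a = s (vertexIdx a.left) • b k a := by
  ext a'
  rw [idempotent_mul_coord hs, smul_coord, b_coord]
  split_ifs with h
  · rw [h]
  · rw [mul_zero, mul_zero]

theorem b_mul_idempotent {s : E k g} (hs : s ∈ idempotents k g) (a : Idx g) :
    b k a * s = s (vertexIdx a.right) • b k a := by
  ext a'
  rw [mul_idempotent_coord hs, smul_coord, b_coord, mul_comm]
  split_ifs with h
  · rw [h]
  · rw [mul_zero, mul_zero]

theorem eq_of_forall_idempotents {v w : Option (Fin g)}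
    (h : ∀ s ∈ idempotents k g, s (vertexIdx v) = s (vertexIdx w)) : v = w := by
  by_contra hne
  have h := h _ (vertex_mem_idempotents w)
  rw [b_coord, b_coord, if_pos rfl, if_neg (vertexIdx_injective.ne hne)] at h
  exact zero_ne_one h

end Idempotents

section Coefficients

variable {k : Type*} [Field k] {g : ℕ} {n : ℕ}

/-- The coefficient of the basis element `a` in the value of a cochain at the basis elements
`p 0, …, p (n - 1)`. -/
def coeff (p : Fin n → Idx g) (a : Idx g) : Cochain k (E k g) n →ₗ[k] k where
  toFun c := c (fun i => b k (p i)) a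
  map_add' _ _ := rfl
  map_smul' _ _ := rfl

theorem coeff_apply (p : Fin n → Idx g) (a : Idx g) (c : Cochain k (E k g) n) :
    coeff p a c = c (fun i => b k (p i)) a :=
  rfl

theorem coeff_two_apply (a₁ a₂ a : Idx g) (f : Cochain k (E k g) 2) :
    coeff ![a₁, a₂] a f = f ![b k a₁, b k a₂] a :=
  congrArg (fun v => f v a) (List.ofFn_inj.1 rfl)

theorem coeff_three_apply (a₁ a₂ a₃ a : Idx g) (c : Cochain k (E k g) 3) :
    coeff ![a₁, a₂, a₃] a c = c ![b k a₁, b k a₂, b k a₃] a :=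
  congrArg (fun v => c v a) (List.ofFn_inj.1 rfl)

theorem eq_zero_of_coeff_eq_zero {c : Cochain k (E k g) n} (h : ∀ p a, coeff p a c = 0) :
    c = 0 := by
  refine Module.Basis.ext_multilinear (fun _ => basis k g) fun p => ?_
  ext a
  simp only [basis_apply]
  exact h p a

/-- The multilinear map that sends the basis elements `p 0, …, p (n - 1)` to the basis element `a`
and all other sequences of `n` basis elements to `0`. -/
def monomial (k : Type*) [Field k] {g n : ℕ} (p : Fin n → Idx g) (a : Idx g) :
    Cochain k (E k g) n :=
  MultilinearMap.smulRight
    ((MultilinearMap.mkPiAlgebra k (Fin n) k).compLinearMap fun i => (basis k g).coord (p i))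
    (b k a)

theorem monomial_apply (p : Fin n → Idx g) (a : Idx g) (v : Fin n → E k g) :
    monomial k p a v = (∏ i, v i (p i)) • b k a :=
  rfl

theorem coeff_monomial (p q : Fin n → Idx g) (a a' : Idx g) :
    coeff q a' (monomial k p a) = if q = p ∧ a' = a then 1 else 0 := by
  rw [coeff_apply, monomial_apply, smul_coord, b_coord]
  simp only [b_coord, eq_comm (a := p _), Finset.prod_ite_zero]
  simp [← ite_and, funext_iff, and_comm]

theorem monomial_update {p : Fin n → Idx g} {v : Fin n → E k g} {i : Fin n} {x : E k g} {r : k}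
    (hx : x (p i) = r * v i (p i)) (a : Idx g) :
    monomial k p a (Function.update v i x) = r • monomial k p a v := by
  have hcoord (j : Fin n) :
      Function.update v i x j (p j) = Function.update v i (r • v i) j (p j) := by
    rcases eq_or_ne j i with rfl | hj
    · rw [Function.update_self, Function.update_self, hx, smul_coord]
    · rw [Function.update_of_ne hj, Function.update_of_ne hj]
  conv_rhs => rw [← Function.update_eq_self i v]
  rw [← MultilinearMap.map_update_smul, monomial_apply, monomial_apply]
  simp only [hcoord]

/-- The condition that the basis elements `p 0, …, p n` other than the idempotents are composable,
and that `a` has the same endpoints as their product and degree `d` more. These are the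
coefficients that can be nonzero for a normalized relative cochain of degree `d`. -/
structure IsCompatible (d : ℤ) (p : Fin (n + 1) → Idx g) (a : Idx g) : Prop where
  left_eq : a.left = (p 0).left
  right_eq : a.right = (p (Fin.last n)).right
  composable (j : Fin n) : (p j.castSucc).right = (p j.succ).left
  deg_eq : a.deg = ∑ i, (p i).deg + d
  isArrow (i : Fin (n + 1)) : (p i).IsArrow

theorem isCompatible_of_coeff_ne_zero {d : ℤ} {c : Cochain k (E k g) (n + 1)}
    (hc : c ∈ relCochains (grading k g) (idempotents k g) d (n + 1)) {p : Fin (n + 1) → Idx g}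
    {a : Idx g} (h : coeff p a c ≠ 0) : IsCompatible d p a := by
  obtain ⟨hdeg, hrel, hnormalized⟩ := hc
  set v : Fin (n + 1) → E k g := fun i => b k (p i)
  have hv (r : k) (i : Fin (n + 1)) : c (Function.update v i (r • b k (p i))) a = r * c v a := by
    rw [MultilinearMap.map_update_smul, Function.update_eq_self, smul_coord]
  refine ⟨eq_of_forall_idempotents (k := k) fun s hs => ?_,
    eq_of_forall_idempotents (k := k) fun s hs => ?_,
    fun j => eq_of_forall_idempotents (k := k) fun s hs => ?_, ?_, fun i => ?_⟩
  · have left := congrFun (hrel s hs v).1 a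
    rw [idempotent_mul_b hs, hv, idempotent_mul_coord hs] at left
    exact mul_right_cancel₀ h left.symm
  · have right := congrFun (hrel s hs v).2.1 a
    rw [b_mul_idempotent hs, hv, mul_idempotent_coord hs, mul_comm] at right
    exact mul_left_cancel₀ h right.symm
  · have middle := congrFun ((hrel s hs v).2.2 j) a
    rw [b_mul_idempotent hs, idempotent_mul_b hs, hv, hv] at middle
    exact mul_right_cancel₀ h middle
  · exact not_not.1 fun hne => h (hdeg _ v (fun i => b_mem_grading (p i)) a hne)
  · by_contra hi
    obtain ⟨w, hw⟩ := Idx.exists_vertexIdx_eq hi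
    have hmem : b k (p i) ∈ idempotents k g := hw ▸ vertex_mem_idempotents w
    exact h (congrFun (hnormalized v i hmem) a)

theorem monomial_mem_relCochains {d : ℤ} {p : Fin (n + 1) → Idx g} {a : Idx g}
    (h : IsCompatible d p a) :
    monomial k p a ∈ relCochains (grading k g) (idempotents k g) d (n + 1) := by
  refine ⟨fun e v hv => ?_, fun s hs v => ⟨?_, ?_, fun j => ?_⟩, fun v i hi => ?_⟩
  · rw [monomial_apply]
    by_cases hne : ∀ i, v i (p i) ≠ 0
    · have he (i : Fin (n + 1)) : (p i).deg = e i := not_not.1 fun hd => hne i (hv i _ hd)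
      simp only [← he, ← h.deg_eq]
      exact Submodule.smul_mem _ _ (b_mem_grading a)
    · obtain ⟨i, hi⟩ := not_forall_not.1 hne
      rw [Finset.prod_eq_zero (Finset.mem_univ i) hi, zero_smul]
      exact zero_mem _
  · rw [monomial_update (idempotent_mul_coord hs _ _), monomial_apply, mul_smul_comm,
      idempotent_mul_b hs, h.left_eq, smul_comm]
  · rw [monomial_update ((mul_idempotent_coord hs _ _).trans (mul_comm _ _)), monomial_apply,
      smul_mul_assoc, b_mul_idempotent hs, h.right_eq, smul_comm]
  · rw [monomial_update ((mul_idempotent_coord hs _ _).trans (mul_comm _ _)),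
      monomial_update (idempotent_mul_coord hs _ _), h.composable]
  · rw [monomial_apply, Finset.prod_eq_zero (Finset.mem_univ i)
      (coord_eq_zero_of_isArrow hi (h.isArrow i)), zero_smul]

theorem exists_relCochain_coeff_eq (d : ℤ) (t : (Fin (n + 1) → Idx g) → Idx g → k) :
    ∃ f ∈ relCochains (grading k g) (idempotents k g) d (n + 1),
      ∀ p a, IsCompatible d p a → coeff p a f = t p a := by
  classical
  cases nonempty_fintype (Idx g)
  refine ⟨∑ q : (Fin (n + 1) → Idx g) × Idx g with IsCompatible d q.1 q.2,
    t q.1 q.2 • monomial k q.1 q.2, sum_mem fun q hq => ?_, fun p a h => ?_⟩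
  · exact Submodule.smul_mem _ _ (monomial_mem_relCochains (Finset.mem_filter.1 hq).2)
  · rw [map_sum, Finset.sum_eq_single_of_mem (p, a) (by simpa using h)]
    · simp [coeff_monomial]
    · rintro ⟨q, a'⟩ - hne
      have hne : ¬(p = q ∧ a = a') := fun h => hne (Prod.ext h.1.symm h.2.symm)
      rw [map_smul, coeff_monomial, if_neg hne, smul_zero]

theorem isCompatible_two_iff {d : ℤ} {a₁ a₂ a : Idx g} :
    IsCompatible d ![a₁, a₂] a ↔ (a.left = a₁.left ∧ a.right = a₂.right ∧ a₁.right = a₂.left) ∧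
      a.deg = a₁.deg + a₂.deg + d ∧ a₁.IsArrow ∧ a₂.IsArrow := by
  refine ⟨fun h => ⟨⟨h.left_eq, h.right_eq, h.composable 0⟩, ?_, h.isArrow 0, h.isArrow 1⟩,
    fun h => ⟨h.1.1, h.1.2.1, fun j => ?_, ?_, Fin.forall_fin_two.2 h.2.2⟩⟩
  · simpa [Fin.sum_univ_two] using h.deg_eq
  · rw [Subsingleton.elim j 0]
    exact h.1.2.2
  · simpa [Fin.sum_univ_two] using h.2.1

theorem isCompatible_three_iff {d : ℤ} {a₁ a₂ a₃ a : Idx g} :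
    IsCompatible d ![a₁, a₂, a₃] a ↔
      (a.left = a₁.left ∧ a.right = a₃.right ∧ a₁.right = a₂.left ∧ a₂.right = a₃.left) ∧
      a.deg = a₁.deg + a₂.deg + a₃.deg + d ∧ a₁.IsArrow ∧ a₂.IsArrow ∧ a₃.IsArrow := by
  refine ⟨fun h => ⟨⟨h.left_eq, h.right_eq, h.composable 0, h.composable 1⟩, ?_, h.isArrow 0,
    h.isArrow 1, h.isArrow 2⟩, fun h => ⟨h.1.1, h.1.2.1, Fin.forall_fin_two.2 h.1.2.2, ?_,
    Fin.forall_fin_succ.2 ⟨h.2.2.1, Fin.forall_fin_two.2 h.2.2.2⟩⟩⟩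
  · simpa [Fin.sum_univ_three] using h.deg_eq
  · simpa [Fin.sum_univ_three] using h.2.1

end Coefficients

section Coboundaries

variable {k : Type*} [Field k] {g : ℕ}

theorem B_mul_Y (i j : Fin g) : b k (.B i) * b k (.Y j) = 0 := by
  ext a
  cases a <;> simp [mul_def, mulFun, b_coord]

theorem Y_mul_A (i j : Fin g) : b k (.Y i) * b k (.A j) = 0 := by
  ext a
  cases a <;> simp [mul_def, mulFun, b_coord]

theorem A_mul_X (i j : Fin g) : b k (.A i) * b k (.X j) = 0 := by
  ext a
  cases a <;> simp [mul_def, mulFun, b_coord]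

theorem two_apply_zero_left (f : Cochain k (E k g) 2) (y : E k g) : f ![0, y] = 0 :=
  f.map_coord_zero 0 rfl

theorem two_apply_zero_right (f : Cochain k (E k g) 2) (x : E k g) : f ![x, 0] = 0 :=
  f.map_coord_zero 1 rfl

variable (f : Cochain k (E k g) 2)

theorem coeff_diff_ABY (i : Fin g) :
    coeff ![.A i, .B i, .Y i] (.Y i) (diff (grading k g) (-1) 2 f) =
      coeff ![.B i, .Y i] (.B i) f - coeff ![.Y i, .Y i] (.Y i) f -
        coeff ![.A i, .B i] (.eP i) f := by
  simp only [coeff_three_apply, coeff_two_apply, diff_two_apply, A_mul_B, B_mul_Y, if_pos,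
    two_apply_zero_right]
  simp [sub_coord, mul_def, mulFun, koszulTwist_coord, Idx.deg, b_coord]

theorem coeff_diff_YAB (i : Fin g) :
    coeff ![.Y i, .A i, .B i] (.Y i) (diff (grading k g) (-1) 2 f) =
      -coeff ![.A i, .B i] (.eP i) f + coeff ![.Y i, .Y i] (.Y i) f -
        coeff ![.Y i, .A i] (.A i) f := by
  simp only [coeff_three_apply, coeff_two_apply, diff_two_apply, A_mul_B, Y_mul_A, if_pos,
    two_apply_zero_left]
  simp [sub_coord, mul_def, mulFun, koszulTwist_coord, Idx.deg, b_coord]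

theorem coeff_diff_BYA (i l : Fin g) :
    coeff ![.B i, .Y i, .A i] (.X l) (diff (grading k g) (-1) 2 f) =
      if l = i then -coeff ![.Y i, .A i] (.A i) f - coeff ![.B i, .Y i] (.B i) f else 0 := by
  simp only [coeff_three_apply, coeff_two_apply, diff_two_apply, B_mul_Y, Y_mul_A,
    two_apply_zero_left, two_apply_zero_right]
  split_ifs with hl
  · simp [sub_coord, mul_def, mulFun, koszulTwist_coord, Idx.deg, b_coord, hl]
  · simp [sub_coord, mul_def, mulFun, koszulTwist_coord, Idx.deg, b_coord, hl]

theorem coeff_diff_ABA (i j : Fin g) :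
    coeff ![.A i, .B j, .A j] (.A i) (diff (grading k g) (-1) 2 f) =
      coeff ![.B j, .A j] .eO f - (if i = j then coeff ![.Y i, .A i] (.A i) f else 0) +
        coeff ![.A i, .X j] (.A i) f - if i = j then coeff ![.A i, .B i] (.eP i) f else 0 := by
  simp only [coeff_three_apply, coeff_two_apply, diff_two_apply, A_mul_B, B_mul_A, if_pos]
  split_ifs with hij
  · simp [sub_coord, mul_def, mulFun, koszulTwist_coord, Idx.deg, b_coord, hij]
  · simp [sub_coord, mul_def, mulFun, koszulTwist_coord, Idx.deg, b_coord, hij,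
      two_apply_zero_left]

theorem coeff_diff_BAB (i j : Fin g) :
    coeff ![.B i, .A i, .B j] (.B j) (diff (grading k g) (-1) 2 f) =
      -(if j = i then coeff ![.A i, .B i] (.eP i) f else 0) - coeff ![.X i, .B j] (.B j) f +
        (if j = i then coeff ![.B i, .Y i] (.B i) f else 0) - coeff ![.B i, .A i] .eO f := by
  simp only [coeff_three_apply, coeff_two_apply, diff_two_apply, A_mul_B, B_mul_A, if_pos,
    eq_comm (a := i)]
  split_ifs with hji
  · simp [sub_coord, mul_def, mulFun, koszulTwist_coord, Idx.deg, b_coord, hji]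
  · simp [sub_coord, mul_def, mulFun, koszulTwist_coord, Idx.deg, b_coord, hji,
      two_apply_zero_right]

theorem coeff_diff_BAX (i j l : Fin g) :
    coeff ![.B i, .A i, .X j] (.X l) (diff (grading k g) (-1) 2 f) =
      -(if l = i then coeff ![.A i, .X j] (.A i) f else 0) - coeff ![.X i, .X j] (.X l) f -
        if l = j then coeff ![.B i, .A i] .eO f else 0 := by
  simp only [coeff_three_apply, coeff_two_apply, diff_two_apply, B_mul_A, A_mul_X, if_pos,
    two_apply_zero_right]
  rcases eq_or_ne l i with rfl | hli
  · simp [sub_coord, mul_def, mulFun, koszulTwist_coord, Idx.deg, b_coord]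
  · simp [sub_coord, mul_def, mulFun, koszulTwist_coord, Idx.deg, b_coord, hli]

end Coboundaries

section Cocycles

variable {k : Type*} [Field k] {g : ℕ} {c : Cochain k (E k g) 3}

theorem cocycle_identity_ABAB (hc : diff (grading k g) (-1) 3 c = 0) (i j : Fin g) :
    coeff ![.B j, .A j, .B i] (.B i) c
      - (if i = j then coeff ![.Y i, .A i, .B i] (.Y i) c else 0)
      + coeff ![.A i, .X j, .B i] (.Y i) c
      - (if i = j then coeff ![.A i, .B i, .Y i] (.Y i) c else 0)
      + coeff ![.A i, .B j, .A j] (.A i) c = 0 := by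
  have identity := congrFun
    (cocycle_identity hc (b k (.A i)) (b k (.B j)) (b k (.A j)) (b k (.B i))) (.Y i)
  have zero_left : c ![0, b k (.A j), b k (.B i)] = 0 := c.map_coord_zero 0 rfl
  have zero_right : c ![b k (.A i), b k (.B j), 0] = 0 := c.map_coord_zero 2 rfl
  simp only [A_mul_B, B_mul_A, if_pos, eq_comm (a := j)] at identity
  simp only [coeff_three_apply]
  split_ifs at identity ⊢ with hij
  · simpa [sub_coord, mul_def, mulFun, koszulTwist_coord, Idx.deg, b_coord, hij] using identity
  · simpa [mul_def, mulFun, koszulTwist_coord, Idx.deg, b_coord, zero_left, zero_right]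
      using identity

theorem cocycle_identity_BABA (hc : diff (grading k g) (-1) 3 c = 0) (i j l : Fin g) :
    -(if l = i then coeff ![.A i, .B j, .A j] (.A i) c else 0)
      - coeff ![.X i, .B j, .A j] (.X l) c
      + (if i = j then coeff ![.B i, .Y i, .A i] (.X l) c else 0)
      - coeff ![.B i, .A i, .X j] (.X l) c
      + (if l = j then coeff ![.B i, .A i, .B j] (.B j) c else 0) = 0 := by
  have identity := congrFun
    (cocycle_identity hc (b k (.B i)) (b k (.A i)) (b k (.B j)) (b k (.A j))) (.X l)
  have left_mul (x : E k g) : (koszulTwist (grading k g) (-1) (b k (.B i)) * x) (.X l) =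
      -if l = i then x (.A i) else 0 := by
    split_ifs with hli
    · simp [mul_def, mulFun, koszulTwist_coord, Idx.deg, b_coord, hli]
    · simp [mul_def, mulFun, koszulTwist_coord, Idx.deg, b_coord, hli]
  have right_mul (x : E k g) : (x * b k (.A j)) (.X l) = if l = j then x (.B j) else 0 := by
    split_ifs with hlj
    · simp [mul_def, mulFun, b_coord, hlj]
    · simp [mul_def, mulFun, b_coord, hlj]
  have middle : c ![b k (.B i), b k (.A i) * b k (.B j), b k (.A j)] (.X l) =
      if i = j then c ![b k (.B i), b k (.Y i), b k (.A i)] (.X l) else 0 := by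
    rw [A_mul_B]
    split_ifs with hij
    · rw [hij]
    · exact congrFun (c.map_coord_zero 1 rfl) _
  simpa only [coeff_three_apply, add_coord, sub_coord, zero_coord, left_mul, right_mul, middle,
    B_mul_A, if_pos] using identity

end Cocycles

section Relative

variable {k : Type*} [Field k] {g : ℕ} {c : Cochain k (E k g) 3}

theorem IsCompatible.cases {a₁ a₂ a₃ a : Idx g} (h : IsCompatible (-1) ![a₁, a₂, a₃] a) :
    (∃ i, (a₁, a₂, a₃, a) = (.A i, .B i, .Y i, .Y i)) ∨
    (∃ i, (a₁, a₂, a₃, a) = (.Y i, .A i, .B i, .Y i)) ∨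
    (∃ i l, (a₁, a₂, a₃, a) = (.B i, .Y i, .A i, .X l)) ∨
    (∃ i j, (a₁, a₂, a₃, a) = (.A i, .B j, .A j, .A i)) ∨
    (∃ i j, (a₁, a₂, a₃, a) = (.B i, .A i, .B j, .B j)) ∨
    (∃ i j l, (a₁, a₂, a₃, a) = (.B i, .A i, .X j, .X l)) ∨
    (∃ i j, (a₁, a₂, a₃, a) = (.A i, .X j, .B i, .Y i)) ∨
    (∃ i j l, (a₁, a₂, a₃, a) = (.X i, .B j, .A j, .X l)) := by
  rw [isCompatible_three_iff] at h
  cases a₁ <;> cases a₂ <;>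
    simp only [Idx.IsArrow, Idx.left, Idx.right, reduceCtorEq, false_and, and_false] at h <;>
    cases a₃ <;> simp only [reduceCtorEq, false_and, and_false] at h <;>
    cases a <;> grind [Idx.deg]

theorem eq_zero_of_coeff_eq_zero_of_mem_relCocycles
    (hc : c ∈ cocycles (grading k g) (-1) (relCochains (grading k g) (idempotents k g) (-1)) 3)
    (hABY : ∀ i, coeff ![.A i, .B i, .Y i] (.Y i) c = 0)
    (hYAB : ∀ i, coeff ![.Y i, .A i, .B i] (.Y i) c = 0)
    (hBYA : ∀ i l, coeff ![.B i, .Y i, .A i] (.X l) c = 0)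
    (hABA : ∀ i j, coeff ![.A i, .B j, .A j] (.A i) c = 0)
    (hBAB : ∀ i j, coeff ![.B i, .A i, .B j] (.B j) c = 0)
    (hBAX : ∀ i j l, coeff ![.B i, .A i, .X j] (.X l) c = 0) : c = 0 := by
  refine eq_zero_of_coeff_eq_zero fun p a => ?_
  by_contra h
  obtain ⟨a₁, a₂, a₃, rfl⟩ : ∃ a₁ a₂ a₃, p = ![a₁, a₂, a₃] :=
    ⟨_, _, _, (FinVec.etaExpand_eq p).symm⟩
  obtain ⟨i, ⟨⟩⟩ | ⟨i, ⟨⟩⟩ | ⟨i, l, ⟨⟩⟩ | ⟨i, j, ⟨⟩⟩ | ⟨i, j, ⟨⟩⟩ | ⟨i, j, l, ⟨⟩⟩ | ⟨i, j, ⟨⟩⟩ |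
    ⟨i, j, l, ⟨⟩⟩ := (isCompatible_of_coeff_ne_zero hc.1 h).cases
  · exact h (hABY i)
  · exact h (hYAB i)
  · exact h (hBYA i l)
  · exact h (hABA i j)
  · exact h (hBAB i j)
  · exact h (hBAX i j l)
  · exact h (by simpa [hBAB, hABA, hABY, hYAB] using cocycle_identity_ABAB hc.2 i j)
  · exact h (by simpa [hABA, hBYA, hBAX, hBAB] using cocycle_identity_BABA hc.2 i j l)

end Relative

section Gauge

variable {k : Type*} [Field k] {g : ℕ} {c : Cochain k (E k g) 3}

theorem exists_relCochain_two_coeff_eq (YY YA BY : Fin g → k) (AX XB : Fin g → Fin g → k)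
    (XX : Fin g → Fin g → Fin g → k) :
    ∃ f ∈ relCochains (grading k g) (idempotents k g) (-1) 2,
      (∀ i, coeff ![.A i, .B i] (.eP i) f = 0) ∧
      (∀ i, coeff ![.B i, .A i] .eO f = 0) ∧
      (∀ i, coeff ![.Y i, .Y i] (.Y i) f = YY i) ∧
      (∀ i, coeff ![.Y i, .A i] (.A i) f = YA i) ∧
      (∀ i, coeff ![.B i, .Y i] (.B i) f = BY i) ∧
      (∀ i j, coeff ![.A i, .X j] (.A i) f = AX i j) ∧
      (∀ i j, coeff ![.X i, .B j] (.B j) f = XB i j) ∧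
      ∀ i j l, coeff ![.X i, .X j] (.X l) f = XX i j l := by
  obtain ⟨f, hf, h⟩ := exists_relCochain_coeff_eq (k := k) (g := g) (n := 1) (-1)
    fun p a => match p 0, p 1, a with
      | .Y i, .Y _, _ => YY i
      | .Y i, .A _, _ => YA i
      | .B i, .Y _, _ => BY i
      | .A i, .X j, _ => AX i j
      | .X i, .B j, _ => XB i j
      | .X i, .X j, .X l => XX i j l
      | _, _, _ => 0
  refine ⟨f, hf, ?_, ?_, ?_, ?_, ?_, ?_, ?_, ?_⟩
  all_goals
    intros
    exact h _ _ (isCompatible_two_iff.2 (by simp [Idx.left, Idx.right, Idx.deg, Idx.IsArrow]))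

theorem exists_add_eq_sub_eq (hk : (2 : k) ≠ 0) (s t : k) : ∃ x y : k, x + y = s ∧ x - y = t :=
  ⟨(s + t) / 2, (s - t) / 2, by field_simp; ring, by field_simp; ring⟩

theorem exists_diff_eq_of_mem_relCocycles (hk : (2 : k) ≠ 0)
    (hc : c ∈ cocycles (grading k g) (-1) (relCochains (grading k g) (idempotents k g) (-1)) 3)
    (hα : ∀ i j, i ≠ j → alpha c i j = 0) :
    ∃ f ∈ relCochains (grading k g) (idempotents k g) (-1) 2, diff (grading k g) (-1) 2 f = c := by
  choose BY YA hadd hsub using fun i => exists_add_eq_sub_eq hk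
    (-coeff ![.B i, .Y i, .A i] (.X i) c)
    (coeff ![.A i, .B i, .Y i] (.Y i) c + coeff ![.Y i, .A i, .B i] (.Y i) c)
  let AX (i j : Fin g) : k :=
    coeff ![.A i, .B j, .A j] (.A i) c + if i = j then YA i else 0
  obtain ⟨f, hf, hAB, hBA, hYY, hYA, hBY, hAX, hXB, hXX⟩ := exists_relCochain_two_coeff_eq
    (fun i => BY i - coeff ![.A i, .B i, .Y i] (.Y i) c) YA BY AX
    (fun i j => -coeff ![.B i, .A i, .B j] (.B j) c + if j = i then BY i else 0)
    (fun i j l => -coeff ![.B i, .A i, .X j] (.X l) c - if l = i then AX i j else 0)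
  have hsubmem : c - diff (grading k g) (-1) 2 f ∈
      cocycles (grading k g) (-1) (relCochains (grading k g) (idempotents k g) (-1)) 3 :=
    sub_mem hc (diff_two_mem_relCocycles mem_grading_zero_of_mem_idempotents hf)
  refine ⟨f, hf, (sub_eq_zero.1 (eq_zero_of_coeff_eq_zero_of_mem_relCocycles hsubmem
    (fun i => ?_) (fun i => ?_) (fun i l => ?_) (fun i j => ?_) (fun i j => ?_)
    fun i j l => ?_)).symm⟩
  · rw [map_sub, coeff_diff_ABY, hAB, hBY, hYY]
    ring
  · rw [map_sub, coeff_diff_YAB, hAB, hYA, hYY]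
    linear_combination -hsub i
  · rw [map_sub, coeff_diff_BYA, hYA, hBY]
    split_ifs with hl
    · rw [hl]
      linear_combination hadd i
    · rw [sub_zero, coeff_three_apply]
      exact hα i l (Ne.symm hl)
  · rw [map_sub, coeff_diff_ABA, hAB, hBA, hYA, hAX]
    simp only [AX]
    split_ifs <;> ring
  · rw [map_sub, coeff_diff_BAB, hAB, hBA, hBY, hXB]
    split_ifs <;> ring
  · rw [map_sub, coeff_diff_BAX, hBA, hAX, hXX]
    split_ifs <;> ring

end Gauge

section OffDiagonal

variable {k : Type*} [Field k] {g : ℕ}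

/-- The relative `3`-cocycle of degree `-1` that realises the matrix unit at `(i, l)`. -/
def elementaryCocycle (k : Type*) [Field k] {g : ℕ} (i l : Fin g) : Cochain k (E k g) 3 :=
  monomial k ![.B i, .Y i, .A i] (.X l) + monomial k ![.B i, .A i, .X i] (.X l)

theorem diff_elementaryCocycle (i l : Fin g) :
    diff (grading k g) (-1) 3 (elementaryCocycle k i l) = 0 := by
  have happly (x y z : E k g) : elementaryCocycle k i l ![x, y, z] =
      (x (.B i) * (y (.Y i) * z (.A i) + y (.A i) * z (.X i))) • b k (.X l) := by
    rw [elementaryCocycle, _root_.add_apply, monomial_apply, monomial_apply, ← add_smul,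
      Fin.prod_univ_three, Fin.prod_univ_three]
    exact congrArg (· • b k (.X l)) (by rw [mul_add, ← mul_assoc, ← mul_assoc]; rfl)
  refine Cochain.ext_four fun x y z w => ?_
  simp only [diff_three_apply, happly]
  ext a
  cases a with
  | X j =>
    simp only [Algebra.mul_smul_comm, Algebra.smul_mul_assoc, mul_def, mulFun, add_coord,
      sub_coord, smul_coord, koszulTwist_coord, b_coord, Idx.deg, Idx.X.injEq, reduceCtorEq,
      if_false, mul_zero, Int.negOnePow_zero, Units.val_one, Int.cast_one, zero_apply, zero_coord]
    ring
  | _ => simp [sub_coord, mul_def, mulFun, koszulTwist_coord, b_coord, Idx.deg]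

theorem elementaryCocycle_mem_relCocycles (i l : Fin g) :
    elementaryCocycle k i l ∈ cocycles (grading k g) (-1)
      (relCochains (grading k g) (idempotents k g) (-1)) 3 := by
  refine ⟨add_mem ?_ ?_, diff_elementaryCocycle i l⟩
  all_goals
    exact monomial_mem_relCochains (isCompatible_three_iff.2
      (by simp [Idx.left, Idx.right, Idx.deg, Idx.IsArrow]))

theorem alpha_eq_coeff (c : Cochain k (E k g) 3) (i j : Fin g) :
    alpha c i j = coeff ![.B i, .Y i, .A i] (.X j) c :=
  (coeff_three_apply _ _ _ _ c).symm

theorem alpha_elementaryCocycle (i l i' j : Fin g) :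
    alpha (elementaryCocycle k i l) i' j = if i' = i ∧ j = l then 1 else 0 := by
  rw [alpha_eq_coeff, elementaryCocycle, map_add, coeff_monomial, coeff_monomial]
  simp

/-- The off-diagonal part of the matrix `(α_{ij}(c))`, with zeros put on the diagonal. -/
def alphaMap (k : Type*) [Field k] (g : ℕ) : Cochain k (E k g) 3 →ₗ[k] zeroDiag k g where
  toFun c := ⟨fun i j => if i = j then 0 else alpha c i j, fun _ => if_pos rfl⟩
  map_add' c c' := by
    ext i j
    change (if i = j then 0 else alpha c i j + alpha c' i j) =
      (if i = j then 0 else alpha c i j) + if i = j then 0 else alpha c' i j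
    split_ifs
    · rw [add_zero]
    · rfl
  map_smul' r c := by
    ext i j
    change (if i = j then 0 else r * alpha c i j) = r * if i = j then 0 else alpha c i j
    rw [mul_ite, mul_zero]

theorem alphaMap_apply (c : Cochain k (E k g) 3) (i j : Fin g) :
    (alphaMap k g c : Matrix (Fin g) (Fin g) k) i j = if i = j then 0 else alpha c i j :=
  rfl

theorem alphaMap_eq_zero_iff {c : Cochain k (E k g) 3} :
    alphaMap k g c = 0 ↔ ∀ i j, i ≠ j → alpha c i j = 0 := by
  simp only [← Subtype.coe_inj, ← Matrix.ext_iff, alphaMap_apply, ZeroMemClass.coe_zero,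
    Matrix.zero_apply, ite_eq_left_iff, ne_eq]

theorem alphaMap_diff (f : Cochain k (E k g) 2) :
    alphaMap k g (diff (grading k g) (-1) 2 f) = 0 :=
  alphaMap_eq_zero_iff.2 fun i j hij => by
    rw [alpha_eq_coeff, coeff_diff_BYA, if_neg hij.symm]

theorem exists_mem_relCocycles_alphaMap_eq (M : zeroDiag k g) :
    ∃ c ∈ cocycles (grading k g) (-1) (relCochains (grading k g) (idempotents k g) (-1)) 3,
      alphaMap k g c = M := by
  refine ⟨∑ i, ∑ l, M.1 i l • elementaryCocycle k i l, sum_mem fun i _ => sum_mem fun l _ =>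
    Submodule.smul_mem _ _ (elementaryCocycle_mem_relCocycles i l), ?_⟩
  ext i j
  rw [alphaMap_apply]
  split_ifs with hij
  · rw [hij]
    exact (M.2 j).symm
  · simp only [alpha_eq_coeff, map_sum, map_smul]
    simp [← alpha_eq_coeff, alpha_elementaryCocycle, ite_and]

theorem relCochains_apply_BYA {c : Cochain k (E k g) 3}
    (hc : c ∈ relCochains (grading k g) (idempotents k g) (-1) 3) (i : Fin g) :
    c ![b k (.B i), b k (.Y i), b k (.A i)] = ∑ j, alpha c i j • b k (.X j) := by
  ext a
  rw [← coeff_three_apply, sum_coord]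
  simp only [smul_coord, b_coord]
  by_cases ha : ∃ l, a = .X l
  · obtain ⟨l, rfl⟩ := ha
    simp [alpha_eq_coeff]
  · push Not at ha
    rw [Finset.sum_eq_zero fun j _ => by rw [if_neg (ha j), mul_zero]]
    by_contra h
    obtain ⟨⟨hleft, hright, -⟩, hdeg, -⟩ :=
      isCompatible_three_iff.1 (isCompatible_of_coeff_ne_zero hc h)
    cases a <;> simp_all [Idx.left, Idx.right, Idx.deg]

end OffDiagonal

section Cohomology

variable {k : Type*} [Field k] {g : ℕ} {c : Cochain k (E k g) 3}

theorem alphaMap_eq_zero_iff_mem_relCoboundaries (hk : (2 : k) ≠ 0)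
    (hc : c ∈ cocycles (grading k g) (-1) (relCochains (grading k g) (idempotents k g) (-1)) 3) :
    alphaMap k g c = 0 ↔
      c ∈ coboundaries (grading k g) (-1) (relCochains (grading k g) (idempotents k g) (-1)) 3 := by
  refine ⟨fun h => exists_diff_eq_of_mem_relCocycles hk hc (alphaMap_eq_zero_iff.1 h), ?_⟩
  rintro ⟨f, -, rfl⟩
  exact alphaMap_diff f

theorem alphaMap_eq_zero_iff_mem_coboundaries (hk : (2 : k) ≠ 0)
    (hc : c ∈ cocycles (grading k g) (-1) (cochains (grading k g) (-1)) 3) :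
    alphaMap k g c = 0 ↔ c ∈ coboundaries (grading k g) (-1) (cochains (grading k g) (-1)) 3 := by
  constructor
  · intro h
    obtain ⟨f, hf, hcf⟩ := exists_sub_diff_mem_relCocycles isSeparabilitySystem_vertices
      mem_grading_zero_of_mem_idempotents hc
    obtain ⟨f', hf', hdiff⟩ := (alphaMap_eq_zero_iff_mem_relCoboundaries hk hcf).1 (by
      rw [map_sub, h, alphaMap_diff, sub_zero])
    exact ⟨f' + f, add_mem hf'.1 hf, by rw [map_add, hdiff, sub_add_cancel]⟩
  · rintro ⟨f, -, rfl⟩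
    exact alphaMap_diff f

end Cohomology

end Egg

end

theorem mainTheorem3 (k : Type*) [Field k] (hk : ringChar k ≠ 2) (g : ℕ) :
    (∃ Φ : Hochschild.HH (Egg.grading k g) 3 (-1) ≃ₗ[k] Egg.zeroDiag k g,
      ∀ (c : Hochschild.cocycles (Egg.grading k g) (-1)
          (Hochschild.cochains (Egg.grading k g) (-1)) 3) (i j : Fin g), i ≠ j →
        (Φ (Submodule.Quotient.mk c) : Matrix (Fin g) (Fin g) k) i j = Egg.alpha c.1 i j) ∧
    (∃ Φ : Hochschild.RelHH (Egg.grading k g) (Egg.idempotents k g) 3 (-1) ≃ₗ[k]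
        Egg.zeroDiag k g,
      ∀ (c : Hochschild.cocycles (Egg.grading k g) (-1)
          (Hochschild.relCochains (Egg.grading k g) (Egg.idempotents k g) (-1)) 3) (i : Fin g),
        c.1 ![Egg.b k (.B i), Egg.b k (.Y i), Egg.b k (.A i)]
            = ∑ j, Egg.alpha c.1 i j • Egg.b k (.X j) ∧
        ∀ j, i ≠ j →
          (Φ (Submodule.Quotient.mk c) : Matrix (Fin g) (Fin g) k) i j = Egg.alpha c.1 i j) := by
  have h2 : (2 : k) ≠ 0 := Ring.two_ne_zero hk
  constructor
  · obtain ⟨Φ, hΦ⟩ := Hochschild.exists_cohomology_equiv (Egg.alphaMap k g)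
      (fun M =>
        let ⟨c, hc, hcM⟩ := Egg.exists_mem_relCocycles_alphaMap_eq M
        ⟨c, ⟨hc.1.1, hc.2⟩, hcM⟩)
      (fun _ => Egg.alphaMap_eq_zero_iff_mem_coboundaries h2)
    refine ⟨Φ, fun c i j hij => ?_⟩
    rw [hΦ, Egg.alphaMap_apply, if_neg hij]
  · obtain ⟨Φ, hΦ⟩ := Hochschild.exists_cohomology_equiv (Egg.alphaMap k g)
      Egg.exists_mem_relCocycles_alphaMap_eq
      (fun _ => Egg.alphaMap_eq_zero_iff_mem_relCoboundaries h2)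
    refine ⟨Φ, fun c i => ⟨Egg.relCochains_apply_BYA c.2.1 i, fun j hij => ?_⟩⟩
    rw [hΦ, Egg.alphaMap_apply, if_neg hij]
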